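/- For each sample size $n$ consider the linear functional additive regression $Y_i=\sum_{j=1}^{p_n}\int_0^1\beta_j(t)X_{ij}(t)\,dt+\varepsilon_i$, $i=1,\dots,n$, with deterministic (conditioned on) predictors $X_{ij}\in L^2([0,1])$, coefficient functions $\beta_j\in L^2([0,1])$ (all of these may depend on $n$) and errors $\varepsilon_1,\dots,\varepsilon_n$ i.i.d. $N(0,\sigma^2)$. Let $\mathfrak M_0=\{j:\beta_j\ne0\}$ and $s_n=|\mathfrak M_0|$. Let $(b_l)_{l\ge1}$ be an orthonormal basis of $L^2([0,1])$, $\theta_{ijl}=\langle X_{ij},b_l\rangle$, $d_{jl}=(n^{-1}\sum_i\theta_{ijl}^2)^{1/2}$, and let $q_n$ be the number of basis functions used. Let $\Theta_j\in\mathbb R^{n\times q_n}$ have entries $\theta_{ijl}/d_{jl}$ (each column standardized to Euclidean norm $\sqrt n$), let $\eta_{0j}=(d_{jl}\langle\beta_j,b_l\rangle)_{l\le q_n}$, and for $S\subset\{1,\dots,p_n\}$ let $\Theta_S$, $\eta_S$ be formed by the blocks $\Theta_j$, $\eta_j$, $j\in S$. For penalties $\rho_\lambda$ and a sequence $\lambda_n>0$,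 consider the criterion $$Q_n(\eta)=\frac1{2n}\Big\|Y-\sum_{j}\Theta_j\eta_j\Big\|^2+\sum_{j}\rho_{\lambda_n}\Big(\frac1{\sqrt n}\|\Theta_j\eta_j\|\Big),\qquad \eta\in\mathbb R^{p_nq_n}.$$ Put $a_n=\min_{j\in\mathfrak M_0}\|\Theta_j\eta_{0j}\|/\sqrt n$ and $\rho_\lambda'(0+)=\lim_{t\downarrow0}\rho'_\lambda(t)\in[0,\infty]$. **Theorem.** For every $\sigma\ge0$ there is a constant $\kappa>0$ depending only on $\sigma$ such that the following holds. Assume: 1. There are constants $C,\widetilde C$ with $\sum_{l\ge1}\theta_{ijl}^2l^4\le C^2$ for all $i,j$ (and all $n$) and $\int_0^1\beta_j^2\le\widetilde C$ for all $j\in\mathfrak M_0$. 2. For each $\lambda>0$, $\rho_\lambda$ is concave and nondecreasing on $[0,\infty)$ and differentiable on $(0,\infty)$ with nonincreasing derivative, and $\rho_\lambda'(0+)>0$. 3. $n^\alpha a_n\to\infty$ for some $\alpha\in(0,\frac12)$. 4. $\rho'_{\lambda_n}(a_n/2)=o(n^{-\alpha}q_n^{-1}s_n^{-1/2})$; for large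 $n$, $\rho_{\lambda_n}$ is twice differentiable on $[a_n/2,\infty)$, and $\sup_{t\ge a_n/2}|\rho''_{\lambda_n}(t)|=o(1)$. 5. For large $n$: all $d_{jl}$, $j\le p_n$, $l\le q_n$, are nonzero, $\Theta_j^T\Theta_j$ is invertible for $j\notin\mathfrak M_0$, and, for some constant $c_0>0$, all eigenvalues of $n^{-1}\Theta_{\mathfrak M_0}^T\Theta_{\mathfrak M_0}$ lie in $[c_0,c_0^{-1}]$ and $$\max_{j\notin\mathfrak M_0}\big\|\Theta_j(\Theta_j^T\Theta_j)^{-1}\Theta_j^T\Theta_{\mathfrak M_0}(\Theta_{\mathfrak M_0}^T\Theta_{\mathfrak M_0})^{-1}\big\|_{\infty,2}<\frac{\sqrt{c_0}}{2\sqrt n}\,\frac{\rho'_{\lambda_n}(0+)}{\rho'_{\lambda_n}(a_n/2)},$$ where $\|B\|_{\infty,2}=\sup_{\|x\|_\infty=1}\|Bx\|_2$ and the ratio is $\infty$ if its denominator is $0$ or its numerator is $\infty$. 6. $q_n+\log p_n=O(n\lambda_n^2)$, with $q_n+\log p_n\le\kappa\, n\,\rho'_{\lambda_n}(0+)^2$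 for large $n$; $\lambda_nn^\alpha q_n\sqrt{s_n}\to0$; $\log(p_nq_n)=o(n^{1-2\alpha}s_n^{-1}q_n^{-2})$; $s_nq_n^{-2}=o(\lambda_n)$. 7. $\rho'_{\lambda_n}(a_n/2)=o(a_nn^{\alpha-1/2}s_n^{-1/2})$, $\sup_{t\ge a_n/2}|\rho''_{\lambda_n}(t)|=O(n^{-1/2})$, $s_n=o(n^{2\alpha})$, and $s_nq_n^{-2}=o(n^{-1/2})$. Then there are estimators $\hat\eta=\hat\eta_n$ such that, with probability tending to one as $n\to\infty$, $\hat\eta$ is a strict local minimizer of $Q_n$ with $\hat\eta_{\mathfrak M_0^c}=0$, and such that for all (nonrandom) $c=c_n\in\mathbb R^{q_ns_n}$ with $c^Tc=1$, $$c^T\big[(\Theta_{\mathfrak M_0}^T\Theta_{\mathfrak M_0})^{1/2}(\hat\eta_{\mathfrak M_0}-\eta_{0,\mathfrak M_0})+n(\Theta_{\mathfrak M_0}^T\Theta_{\mathfrak M_0})^{-1/2}v_{0,\mathfrak M_0}\big]\xrightarrow{D}N(0,\sigma^2),$$ where $v_{0,\mathfrak M_0}$ is formed by stacking $v_{0,k}=\rho'_{\lambda_n}\big(\tfrac1{\sqrt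 n}\|\Theta_k\eta_{0k}\|\big)\tfrac1{\sqrt n}\frac{\Theta_k^T\Theta_k\eta_{0k}}{\|\Theta_k\eta_{0k}\|}$, $k\in\mathfrak M_0$. -/

import Mathlib

open Filter Topology MeasureTheory ProbabilityTheory Asymptotics Matrix
open scoped ENNReal NNReal MatrixOrder

/-- The space `L²([0,1])` of functional predictors and coefficient functions. -/
abbrev L2I : Type := Lp ℝ 2 (volume.restrict (Set.Icc (0 : ℝ) 1))

/-- The Euclidean norm of a real vector. -/
noncomputable def l2norm {ι : Type*} [Fintype ι] (v : ι → ℝ) : ℝ := ‖WithLp.toLp 2 v‖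

/-- The norm `‖B‖_{∞,2} = sup {‖B x‖₂ : ‖x‖_∞ = 1}` of a matrix. -/
noncomputable def norm_inf_two {ι κ : Type*} [Fintype ι] [Fintype κ] (B : Matrix ι κ ℝ) : ℝ≥0∞ :=
  ⨆ (x : κ → ℝ) (_ : ‖x‖ = 1), ENNReal.ofReal (l2norm (B *ᵥ x))

/-- `x` is a strict local minimizer of `f`. -/
def IsStrictLocalMin {E : Type*} [TopologicalSpace E] (f : E → ℝ) (x : E) : Prop :=
  ∀ᶠ y in 𝓝[≠] x, f x < f y

/-- `ρ'(0+)`: the limit at `0+` (possibly `∞`) of the nonincreasing nonnegative derivative `ρ'`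
on `(0, ∞)`, that is, its supremum. -/
noncomputable def slopeAtZero (ρ : ℝ → ℝ) : ℝ≥0∞ :=
  ⨆ (t : ℝ) (_ : 0 < t), ENNReal.ofReal (deriv ρ t)

/-- The deterministic data of a sequence, indexed by the sample size `n`, of linear functional
additive regressions. -/
structure LinearFAR where
  /-- the number of functional predictors -/
  p : ℕ → ℕ
  /-- the number of basis functions that are used for each predictor -/
  q : ℕ → ℕ
  /-- the orthonormal basis; `b l` is the `(l+1)`-st basis function -/
  b : HilbertBasis ℕ ℝ L2I
  /-- the predictors `X_{ij}` -/
  X : ∀ n, Fin n → Fin (p n) → L2I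
  /-- the true coefficient functions `β_j` -/
  beta : ∀ n, Fin (p n) → L2I
  /-- the penalty functions `ρ_λ(t)` -/
  rho : ℝ → ℝ → ℝ
  /-- the regularization parameter `λ_n` -/
  lam : ℕ → ℝ

namespace LinearFAR

noncomputable section

variable (D : LinearFAR) (n : ℕ)

/-- The `(l+1)`-st basis coefficient `θ_{ij,l+1}` of `X_{ij}` (before standardization). -/
def theta (i : Fin n) (j : Fin (D.p n)) (l : ℕ) : ℝ := inner ℝ (D.b l) (D.X n i j)

/-- `n^{-1/2}` times the Euclidean norm of the column `(θ_{ijl})_i`. -/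
def scale (j : Fin (D.p n)) (l : ℕ) : ℝ := l2norm (fun i => D.theta n i j l) / √n

/-- The design matrix `Θ_j`: the basis coefficients of the `j`-th predictor, each column being
standardized to have Euclidean norm `√n`. -/
def Theta (j : Fin (D.p n)) : Matrix (Fin n) (Fin (D.q n)) ℝ :=
  Matrix.of fun i l => D.theta n i j l / D.scale n j l

/-- The true coefficient vector `η_{0j}` with respect to the standardized columns. -/
def eta0 (j : Fin (D.p n)) : Fin (D.q n) → ℝ :=
  fun l => D.scale n j l * inner ℝ (D.b l) (D.beta n j)

open Classical in
/-- The set `M₀` of true functional predictors. -/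
def M0 : Finset (Fin (D.p n)) := Finset.univ.filter fun j => D.beta n j ≠ 0

/-- The number `s_n` of true functional predictors. -/
def s : ℕ := (D.M0 n).card

/-- The matrix `Θ_{M₀}`, formed by the blocks `Θ_j`, `j ∈ M₀`. -/
def ThetaM0 : Matrix (Fin n) (D.M0 n × Fin (D.q n)) ℝ :=
  Matrix.of fun i k => D.Theta n k.1 i k.2

/-- The Gram matrix `Θ_{M₀}ᵀ Θ_{M₀}`. -/
def gramM0 : Matrix (D.M0 n × Fin (D.q n)) (D.M0 n × Fin (D.q n)) ℝ :=
  (D.ThetaM0 n)ᵀ * D.ThetaM0 n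

/-- The smallest signal `a_n = min_{j ∈ M₀} ‖Θ_j η_{0j}‖ / √n`. -/
def a : ℝ := ⨅ j : D.M0 n, l2norm (D.Theta n j *ᵥ D.eta0 n j) / √n

/-- `ρ_{λ_n}` -/
def pen : ℝ → ℝ := D.rho (D.lam n)

/-- `sup_{t ≥ a_n / 2} |ρ''_{λ_n}(t)|` -/
def curvature : ℝ≥0∞ :=
  ⨆ (t : ℝ) (_ : D.a n / 2 ≤ t), ENNReal.ofReal |deriv (deriv (D.pen n)) t|

/-- The responses `Y_i = ∑_j ∫ β_j(t) X_{ij}(t) dt + ε_i`, for a vector `e` of errors. -/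
def response (e : Fin n → ℝ) : Fin n → ℝ :=
  fun i => (∑ j, ∫ t in Set.Icc (0 : ℝ) 1, D.beta n j t * D.X n i j t) + e i

/-- The linear FAR criterion
`(2n)⁻¹ ‖Y - ∑_j Θ_j η_j‖² + ∑_j ρ_{λ_n}(n^{-1/2} ‖Θ_j η_j‖)`. -/
def criterion (Y : Fin n → ℝ) (η : Fin (D.p n) → Fin (D.q n) → ℝ) : ℝ :=
  1 / (2 * n) * l2norm (Y - ∑ j, D.Theta n j *ᵥ η j) ^ 2
    + ∑ j, D.pen n (1 / √n * l2norm (D.Theta n j *ᵥ η j))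

/-- The vector `v_{0,M₀}` with the blocks
`v_{0,k} = ρ'_{λ_n}(n^{-1/2} ‖Θ_k η_{0k}‖) n^{-1/2} Θ_kᵀ Θ_k η_{0k} / ‖Θ_k η_{0k}‖`. -/
def v0 : D.M0 n × Fin (D.q n) → ℝ := fun k =>
  deriv (D.pen n) (1 / √n * l2norm (D.Theta n k.1 *ᵥ D.eta0 n k.1)) * (1 / √n)
    * (((D.Theta n k.1)ᵀ *ᵥ (D.Theta n k.1 *ᵥ D.eta0 n k.1)) k.2
      / l2norm (D.Theta n k.1 *ᵥ D.eta0 n k.1))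

/-- The vector
`(Θ_{M₀}ᵀ Θ_{M₀})^{1/2} (η_{M₀} - η_{0,M₀}) + n (Θ_{M₀}ᵀ Θ_{M₀})^{-1/2} v_{0,M₀}`. -/
def pivot (η : Fin (D.p n) → Fin (D.q n) → ℝ) : D.M0 n × Fin (D.q n) → ℝ :=
  CFC.sqrt (D.gramM0 n) *ᵥ (fun k => η k.1 k.2 - D.eta0 n k.1 k.2)
    + (n : ℝ) • ((CFC.sqrt (D.gramM0 n))⁻¹ *ᵥ D.v0 n)

end

/-- Smoothness of the predictors (a Sobolev ellipsoid of order two) and boundedness of the true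
coefficient functions. -/
structure BasisCondition (D : LinearFAR) : Prop where
  sobolev : ∃ C : ℝ, ∀ n i j, Summable (fun l : ℕ => D.theta n i j l ^ 2 * ((l : ℝ) + 1) ^ 4) ∧
    ∑' l : ℕ, D.theta n i j l ^ 2 * ((l : ℝ) + 1) ^ 4 ≤ C ^ 2
  beta_bdd : ∃ C : ℝ, ∀ n, ∀ j ∈ D.M0 n, ∫ t in Set.Icc (0 : ℝ) 1, (D.beta n j t) ^ 2 ≤ C

/-- Shape of the penalty, strength of the signal and correlation structure of the predictors. -/
structure ModelCondition (D : LinearFAR) (α : ℝ) : Prop where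
  lam_pos : ∀ n, 0 < D.lam n
  concave : ∀ l : ℝ, 0 < l → ConcaveOn ℝ (Set.Ici 0) (D.rho l)
  mono : ∀ l : ℝ, 0 < l → MonotoneOn (D.rho l) (Set.Ici 0)
  diff : ∀ l : ℝ, 0 < l → ∀ t : ℝ, 0 < t → DifferentiableAt ℝ (D.rho l) t
  deriv_anti : ∀ l : ℝ, 0 < l → AntitoneOn (deriv (D.rho l)) (Set.Ioi 0)
  slope_pos : ∀ l : ℝ, 0 < l → 0 < slopeAtZero (D.rho l)
  alpha_mem : α ∈ Set.Ioo (0 : ℝ) (1 / 2)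
  signal : Tendsto (fun n : ℕ => (n : ℝ) ^ α * D.a n) atTop atTop
  deriv_small : (fun n : ℕ => deriv (D.pen n) (D.a n / 2)) =o[atTop]
    fun n : ℕ => (n : ℝ) ^ (-α) * (D.q n : ℝ)⁻¹ * (D.s n : ℝ) ^ (-(1 / 2) : ℝ)
  twice_diff : ∀ᶠ n in atTop, ∀ t : ℝ, D.a n / 2 ≤ t → DifferentiableAt ℝ (deriv (D.pen n)) t
  curvature_small : Tendsto (fun n => D.curvature n) atTop (𝓝 0)
  /-- Every column can be standardized. -/
  scale_ne : ∀ᶠ n in atTop, ∀ (j : Fin (D.p n)) (l : Fin (D.q n)), D.scale n j l ≠ 0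
  /-- `Θ_jᵀ Θ_j` is invertible for the noise predictors. -/
  noise_inv : ∀ᶠ n in atTop, ∀ j ∉ D.M0 n, IsUnit ((D.Theta n j)ᵀ * D.Theta n j)
  /-- The eigenvalues of `n⁻¹ Θ_{M₀}ᵀ Θ_{M₀}` are bounded from below and above, and noise and
  signal predictors are not too correlated. -/
  design : ∃ c₀ : ℝ, 0 < c₀ ∧ ∀ᶠ n : ℕ in atTop,
    spectrum ℝ ((n : ℝ)⁻¹ • D.gramM0 n) ⊆ Set.Icc c₀ c₀⁻¹ ∧
    ∀ j ∉ D.M0 n,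
      norm_inf_two (D.Theta n j * ((D.Theta n j)ᵀ * D.Theta n j)⁻¹ * (D.Theta n j)ᵀ
          * D.ThetaM0 n * (D.gramM0 n)⁻¹)
        < ENNReal.ofReal (√c₀ / (2 * √n))
          * (slopeAtZero (D.pen n) / ENNReal.ofReal (deriv (D.pen n) (D.a n / 2)))

/-- The growth conditions under which the model is selected consistently. The noise level
`q_n + log p_n` is at most `κ n ρ'_{λ_n}(0+)²`. -/
structure SelectionRates (D : LinearFAR) (α κ : ℝ) : Prop where
  noise : (fun n : ℕ => (D.q n : ℝ) + Real.log (D.p n)) =O[atTop]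
    fun n : ℕ => (n : ℝ) * D.lam n ^ 2
  noise_const : ∀ᶠ n : ℕ in atTop, ENNReal.ofReal ((D.q n : ℝ) + Real.log (D.p n)) ≤
    ENNReal.ofReal (κ * n) * slopeAtZero (D.pen n) ^ 2
  lam_small : Tendsto (fun n : ℕ => D.lam n * (n : ℝ) ^ α * D.q n * √(D.s n)) atTop (𝓝 0)
  dim : (fun n : ℕ => Real.log ((D.p n : ℝ) * D.q n)) =o[atTop]
    fun n : ℕ => (n : ℝ) ^ (1 - 2 * α) * (D.s n : ℝ)⁻¹ * ((D.q n : ℝ) ^ 2)⁻¹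
  approx : (fun n : ℕ => (D.s n : ℝ) * ((D.q n : ℝ) ^ 2)⁻¹) =o[atTop] D.lam

/-- The additional conditions for asymptotic normality. -/
structure NormalityRates (D : LinearFAR) (α : ℝ) : Prop where
  deriv_small : (fun n : ℕ => deriv (D.pen n) (D.a n / 2)) =o[atTop]
    fun n : ℕ => D.a n * (n : ℝ) ^ (α - 1 / 2) * (D.s n : ℝ) ^ (-(1 / 2) : ℝ)
  curvature_small : ∃ K : ℝ, ∀ᶠ n : ℕ in atTop,
    D.curvature n ≤ ENNReal.ofReal (K * (n : ℝ) ^ (-(1 / 2) : ℝ))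
  sparse : (fun n : ℕ => (D.s n : ℝ)) =o[atTop] fun n : ℕ => (n : ℝ) ^ (2 * α)
  approx : (fun n : ℕ => (D.s n : ℝ) * ((D.q n : ℝ) ^ 2)⁻¹) =o[atTop]
    fun n : ℕ => (n : ℝ) ^ (-(1 / 2) : ℝ)

end LinearFAR

/-!
Rescaled by `n^{-1/2}`, the responses are `∑ k, T k u₀ + z`, where `u₀` stacks the true signal
coefficients, `T k` is the block `n^{-1/2} Θ_k`, and `z` holds the errors and the truncation error
of the basis expansion. The truncation error has norm `O(s_n q_n⁻²)`, because the predictors lie in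
a Sobolev ellipsoid (`LinearFAR.abs_inner_sub_sum_le`).

**Signal coefficients.** In the ball of radius `n^{-α}` around `u₀` all fitted blocks have norm at
least `a_n / 2`, where the curvature of the penalty is too small to offset the convexity of the
least squares term. Since moreover the penalty is nondecreasing and the norm is convex, the
criterion restricted to the signal blocks is strongly convex there. On the boundary of the ball it
exceeds its value at `u₀` as soon as `‖Θ_{M₀}ᵀ ε‖` is of smaller order than `n^{1-α}`, so that there
is a stationary point inside (`BlockDesign.exists_isBlockStationary`). This point is unique and
Lipschitz in the errors (`BlockDesign.norm_sub_le_of_isBlockStationary`), hence measurable.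

**Noise coefficients.** The stationary point, padded by zeros, is a strict local minimizer of the
full criterion if the projection of the residual onto the column space of every noise block is
shorter than `√n ρ'(0+)` (`IsBlockStationary.exists_strict_min`). The residual is `(1 - P)(r + ε) +
n Θ_{M₀} G⁻¹ v`, where `r` is the truncation error, `P` projects onto the columns of `Θ_{M₀}`, `G =
Θ_{M₀}ᵀ Θ_{M₀}`, and `v` is the gradient of the penalty, whose entries are at most `ρ'(a_n / 2)`.
Incoherence bounds the last term by half of the slope. The Gaussian term is bounded by an
exponential inequality that only sees the dimension `q_n` of a noise block
(`lintegral_exp_sq_mulVec_le`), together with a union bound; `q_n → ∞` because `s_n q_n⁻² =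
o(n^{-1/2})`.

**Normality.** The first-order condition turns the pivot in direction `c` into `⟨Θ_{M₀} G^{-1/2} c,
ε + r⟩ + n ⟨G^{-1/2} c, v₀ - v⟩`. The part linear in `ε` has exactly the law `N(0, σ²)`, since the
weights form a unit vector, and the rest is bounded by a deterministic null sequence
(`LinearFAR.RegularSample.abs_dotProduct_pivot_sub_le`).
-/

/-! ### Penalized least squares for a block design -/

section Optimisation

/-- Shape of a penalty: concave on `[0, ∞)`, differentiable on `(0, ∞)` with nonnegative and
nonincreasing derivative, and with second derivative bounded by `K` on `[b, ∞)`. -/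
structure PenaltyShape (ρ : ℝ → ℝ) (b K : ℝ) : Prop where
  pos : 0 < b
  curv_nonneg : 0 ≤ K
  concave : ConcaveOn ℝ (Set.Ici 0) ρ
  diff : ∀ t, 0 < t → DifferentiableAt ℝ ρ t
  deriv_nonneg : ∀ t, 0 < t → 0 ≤ deriv ρ t
  anti : AntitoneOn (deriv ρ) (Set.Ioi 0)
  diff_deriv : ∀ t, b ≤ t → DifferentiableAt ℝ (deriv ρ) t
  curv : ∀ t, b ≤ t → |deriv (deriv ρ) t| ≤ K

namespace PenaltyShape

variable {ρ : ℝ → ℝ} {b K : ℝ}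

theorem deriv_lipschitz (h : PenaltyShape ρ b K) {s t : ℝ} (hs : b ≤ s) (ht : b ≤ t) :
    |deriv ρ t - deriv ρ s| ≤ K * |t - s| := by
  have := (convex_Ici b).norm_image_sub_le_of_norm_deriv_le (f := deriv ρ) (C := K)
    (fun x hx => h.diff_deriv x hx) (fun x hx => by simpa using h.curv x hx)
    (x := s) (y := t) hs ht
  simpa using this

/-- The mean value theorem on `[b, ∞)`, in either direction. -/
theorem exists_mean_value (h : PenaltyShape ρ b K) {s t : ℝ} (hs : b ≤ s) (ht : b ≤ t) :
    ∃ ξ, b ≤ ξ ∧ |ξ - s| ≤ |t - s| ∧ ρ t - ρ s = deriv ρ ξ * (t - s) := by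
  have hb := h.pos
  have key : ∀ x y, b ≤ x → x < y → ∃ ξ ∈ Set.Ioo x y, deriv ρ ξ = (ρ y - ρ x) / (y - x) := by
    intro x y hx hxy
    refine exists_deriv_eq_slope ρ hxy ?_ ?_
    · intro z hz
      exact (h.diff z (by linarith [hz.1])).continuousAt.continuousWithinAt
    · intro z hz
      exact (h.diff z (by linarith [hz.1])).differentiableWithinAt
  rcases lt_trichotomy s t with hst | rfl | hst
  · obtain ⟨ξ, ⟨h1, h2⟩, h3⟩ := key s t hs hst
    refine ⟨ξ, by linarith, ?_, ?_⟩
    · rw [abs_of_pos (by linarith), abs_of_pos (by linarith)]; linarith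
    · rw [h3]; field_simp [(sub_pos.2 hst).ne']
  · exact ⟨s, hs, by simp, by simp⟩
  · obtain ⟨ξ, ⟨h1, h2⟩, h3⟩ := key t s ht hst
    refine ⟨ξ, by linarith, ?_, ?_⟩
    · rw [abs_of_neg (by linarith), abs_of_neg (by linarith)]; linarith
    · rw [h3]
      have : s - t ≠ 0 := (sub_pos.2 hst).ne'
      field_simp
      ring

theorem deriv_le (h : PenaltyShape ρ b K) {t : ℝ} (ht : b ≤ t) : deriv ρ t ≤ deriv ρ b :=
  h.anti h.pos (lt_of_lt_of_le h.pos ht) ht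

theorem sub_ge (h : PenaltyShape ρ b K) {s t : ℝ} (hs : b ≤ s) (ht : b ≤ t) :
    -(deriv ρ b * |t - s|) ≤ ρ t - ρ s := by
  obtain ⟨ξ, h1, -, h3⟩ := h.exists_mean_value hs ht
  rw [h3]
  have h4 := h.deriv_le h1
  have h5 := h.deriv_nonneg ξ (lt_of_lt_of_le h.pos h1)
  nlinarith [neg_abs_le (t - s), abs_nonneg (t - s)]

theorem sub_ge_tangent (h : PenaltyShape ρ b K) {s t : ℝ} (hs : b ≤ s) (ht : b ≤ t) :
    deriv ρ s * (t - s) - K * (t - s) ^ 2 ≤ ρ t - ρ s := by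
  obtain ⟨ξ, h1, h2, h3⟩ := h.exists_mean_value hs ht
  have h4 := h.deriv_lipschitz hs h1
  have h5 : |(deriv ρ ξ - deriv ρ s) * (t - s)| ≤ K * (t - s) ^ 2 := by
    rw [abs_mul, ← sq_abs (t - s), sq, ← mul_assoc]
    refine mul_le_mul_of_nonneg_right (h4.trans ?_) (abs_nonneg _)
    exact mul_le_mul_of_nonneg_left h2 h.curv_nonneg
  have := neg_abs_le ((deriv ρ ξ - deriv ρ s) * (t - s))
  rw [h3]
  nlinarith

/-- A penalty with small curvature, composed with the norm, lies above its linearization up to a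
small quadratic error: the norm itself is convex. -/
theorem norm_sub_ge_tangent {F : Type*} [NormedAddCommGroup F] [InnerProductSpace ℝ F]
    (h : PenaltyShape ρ b K) {x y : F} (hx : b ≤ ‖x‖) (hy : b ≤ ‖y‖) :
    deriv ρ ‖x‖ * (inner ℝ x (y - x) / ‖x‖) - K * ‖y - x‖ ^ 2 ≤ ρ ‖y‖ - ρ ‖x‖ := by
  have hx0 : 0 < ‖x‖ := lt_of_lt_of_le h.pos hx
  have h1 := h.sub_ge_tangent hx hy
  have h2 : inner ℝ x (y - x) / ‖x‖ ≤ ‖y‖ - ‖x‖ := by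
    rw [div_le_iff₀ hx0, inner_sub_right, real_inner_self_eq_norm_sq]
    nlinarith [real_inner_le_norm x y]
  have h3 : (‖y‖ - ‖x‖) ^ 2 ≤ ‖y - x‖ ^ 2 := by
    rw [← sq_abs]
    exact pow_le_pow_left₀ (abs_nonneg _) (abs_norm_sub_norm_le y x) 2
  have h4 := mul_le_mul_of_nonneg_left h2 (h.deriv_nonneg _ hx0)
  have h5 := mul_le_mul_of_nonneg_left h3 h.curv_nonneg
  linarith

/-- Near zero the penalty grows at least linearly, with any slope that its derivative exceeds
somewhere. -/
theorem sub_zero_ge (h : PenaltyShape ρ b K) {t t₀ : ℝ} (ht : 0 ≤ t) (h0 : 0 < t₀) (htt : t ≤ t₀) :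
    deriv ρ t₀ * t ≤ ρ t - ρ 0 := by
  rcases ht.eq_or_lt with rfl | ht
  · simp
  have h1 := h.concave.deriv_le_slope (x := 0) (y := t) (by simp) ht.le ht (h.diff t ht)
  have h2 := h.anti ht h0 htt
  rw [slope_def_field, sub_zero, le_div_iff₀ ht] at h1
  nlinarith

end PenaltyShape

variable {ι : Type*} [Fintype ι] {F U : Type*} [NormedAddCommGroup F] [InnerProductSpace ℝ F]
  [NormedAddCommGroup U] [NormedSpace ℝ U]

/-- A design with blocks `T k`, whose Gram operator has its spectrum in `[c₀, c₀⁻¹]`. -/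
structure BlockDesign (T : ι → U →L[ℝ] F) (c₀ : ℝ) : Prop where
  pos : 0 < c₀
  lower : ∀ u, c₀ * ‖u‖ ^ 2 ≤ ‖∑ k, T k u‖ ^ 2
  upper : ∀ u, ∑ k, ‖T k u‖ ^ 2 ≤ c₀⁻¹ * ‖u‖ ^ 2

/-- The criterion restricted to the signal blocks. -/
noncomputable def blockCriterion (T : ι → U →L[ℝ] F) (ρ : ℝ → ℝ) (y : F) (u : U) : ℝ :=
  1 / 2 * ‖y - ∑ k, T k u‖ ^ 2 + ∑ k, ρ ‖T k u‖

/-- First-order condition for a minimizer of `blockCriterion`. -/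
def IsBlockStationary (T : ι → U →L[ℝ] F) (ρ : ℝ → ℝ) (y : F) (u : U) : Prop :=
  ∀ h, inner ℝ (y - ∑ k, T k u) (∑ k, T k h)
    = ∑ k, deriv ρ ‖T k u‖ * (inner ℝ (T k u) (T k h) / ‖T k u‖)

variable {T : ι → U →L[ℝ] F} {c₀ : ℝ} {ρ : ℝ → ℝ} {b K δ : ℝ} {u₀ : U}

theorem BlockDesign.norm_apply_le (hT : BlockDesign T c₀) (u : U) (k : ι) :
    ‖T k u‖ ≤ ‖u‖ / √c₀ := by
  have h1 : ‖T k u‖ ^ 2 ≤ c₀⁻¹ * ‖u‖ ^ 2 :=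
    (Finset.single_le_sum (f := fun k => ‖T k u‖ ^ 2) (fun i _ => by positivity)
      (Finset.mem_univ k)).trans (hT.upper u)
  have := hT.pos
  refine le_of_sq_le_sq ?_ (by positivity)
  rw [div_pow, Real.sq_sqrt hT.pos.le]
  calc _ ≤ _ := h1
    _ = _ := by field_simp

/-- Inside a small ball around the truth, the fitted blocks stay away from zero. -/
theorem BlockDesign.le_norm_apply (hT : BlockDesign T c₀) (hsig : ∀ k, 2 * b ≤ ‖T k u₀‖)
    (hδ : δ ≤ √c₀ * b) {u : U} (hu : ‖u - u₀‖ ≤ δ) (k : ι) : b ≤ ‖T k u‖ := by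
  have h1 := hT.norm_apply_le (u - u₀) k
  have h2 : 0 < √c₀ := Real.sqrt_pos.2 hT.pos
  have h3 : ‖u - u₀‖ / √c₀ ≤ b := by
    rw [div_le_iff₀ h2]; linarith
  have h4 : ‖T k u₀‖ ≤ ‖T k u‖ + ‖T k (u - u₀)‖ := by
    rw [map_sub, norm_sub_rev]
    exact norm_le_insert' _ _
  linarith [hsig k]

theorem hasDerivAt_norm_add_smul {x : F} (hx : x ≠ 0) (h : F) :
    HasDerivAt (fun t : ℝ => ‖x + t • h‖) (inner ℝ x h / ‖x‖) 0 := by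
  have h1 : HasDerivAt (fun t : ℝ => x + t • h) h 0 := by
    simpa using ((hasDerivAt_id (0 : ℝ)).smul_const h).const_add x
  have h2 := h1.norm_sq
  have h3 := h2.sqrt (by simpa using hx)
  simp only [Real.sqrt_sq (norm_nonneg _), zero_smul, add_zero] at h3
  convert h3 using 1
  field_simp

theorem IsLocalMin.isBlockStationary (hdiff : ∀ t, 0 < t → DifferentiableAt ℝ ρ t) {y : F} {u : U}
    (hu : ∀ k, T k u ≠ 0) (hmin : IsLocalMin (blockCriterion T ρ y) u) :
    IsBlockStationary T ρ y u := by
  intro h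
  have h0 : HasDerivAt (fun t : ℝ => u + t • h) h 0 := by
    simpa using ((hasDerivAt_id (0 : ℝ)).smul_const h).const_add u
  have h1 : HasDerivAt (fun t : ℝ => blockCriterion T ρ y (u + t • h))
      (1 / 2 * (2 * inner ℝ (y - ∑ k, T k u) (-∑ k, T k h))
        + ∑ k, deriv ρ ‖T k u‖ * (inner ℝ (T k u) (T k h) / ‖T k u‖)) 0 := by
    unfold blockCriterion
    refine HasDerivAt.add (HasDerivAt.const_mul _ ?_) (HasDerivAt.fun_sum fun k _ => ?_)
    · have h2 : HasDerivAt (fun t : ℝ => y - ∑ k, T k (u + t • h)) (-∑ k, T k h) 0 := by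
        refine HasDerivAt.const_sub _ (HasDerivAt.fun_sum fun k _ => ?_)
        exact (T k).hasFDerivAt.comp_hasDerivAt 0 h0
      simpa using h2.norm_sq
    · have h2 := hasDerivAt_norm_add_smul (hu k) (T k h)
      have h3 : HasDerivAt ρ (deriv ρ ‖T k u‖) ‖T k u + (0 : ℝ) • T k h‖ := by
        simpa using (hdiff ‖T k u‖ (norm_pos_iff.2 (hu k))).hasDerivAt
      simpa [Function.comp_def] using h3.comp (0 : ℝ) h2
  have h2 : IsLocalMin (fun t : ℝ => blockCriterion T ρ y (u + t • h)) 0 := by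
    have : Tendsto (fun t : ℝ => u + t • h) (𝓝 0) (𝓝 u) := by
      simpa using h0.continuousAt.tendsto
    simpa [IsLocalMin, IsMinFilter] using this.eventually hmin
  have h3 := h2.hasDerivAt_eq_zero h1
  rw [inner_neg_right] at h3
  linarith

/-- Existence of a stationary point near the truth: on the sphere of radius `δ` the criterion
exceeds its value at the truth, so that its minimum over the ball is attained in the interior. -/
theorem BlockDesign.exists_isBlockStationary [FiniteDimensional ℝ U] (hT : BlockDesign T c₀)
    (hρ : PenaltyShape ρ b K) (hsig : ∀ k, 2 * b ≤ ‖T k u₀‖) (hδ0 : 0 < δ) (hδ : δ ≤ √c₀ * b)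
    {z : F} {g : ℝ} (hz : ∀ h, inner ℝ z (∑ k, T k h) ≤ g * ‖h‖)
    (hg : g + √(Fintype.card ι) / √c₀ * deriv ρ b < c₀ * δ / 2) :
    ∃ u, ‖u - u₀‖ ≤ δ ∧ IsBlockStationary T ρ (∑ k, T k u₀ + z) u := by
  have hb := hρ.pos
  set y : F := ∑ k, T k u₀ + z with hy
  have hcont : ContinuousOn (blockCriterion T ρ y) (Metric.closedBall u₀ δ) := by
    unfold blockCriterion
    refine ContinuousOn.add (by fun_prop) (continuousOn_finsetSum _ fun k _ => ?_)
    intro u hu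
    have h1 := hT.le_norm_apply hsig hδ (by simpa [dist_eq_norm] using hu) k
    exact ((hρ.diff _ (by linarith)).continuousAt.comp
      (f := fun u => ‖T k u‖) (by fun_prop)).continuousWithinAt
  have := FiniteDimensional.proper ℝ U
  obtain ⟨u, hu, hmin⟩ := (isCompact_closedBall u₀ δ).exists_isMinOn
    ⟨u₀, by simp [hδ0.le]⟩ hcont
  have hu' : ‖u - u₀‖ ≤ δ := by simpa [dist_eq_norm] using hu
  have hbu := hT.le_norm_apply hsig hδ hu'
  have hlt : ‖u - u₀‖ < δ := by
    refine lt_of_le_of_ne hu' fun heq => ?_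
    have h1 : blockCriterion T ρ y u ≤ blockCriterion T ρ y u₀ := hmin (by simp [hδ0.le])
    set h := u - u₀ with hh
    have h2 : y - ∑ k, T k u = z - ∑ k, T k h := by
      simp only [hy, hh, map_sub, Finset.sum_sub_distrib]; abel
    have h3 : y - ∑ k, T k u₀ = z := by simp [hy]
    have h4 : ∑ k, (ρ ‖T k u‖ - ρ ‖T k u₀‖) ≥ -(√(Fintype.card ι) / √c₀ * deriv ρ b * δ) := by
      have h5 : ∀ k, -(deriv ρ b * ‖T k h‖) ≤ ρ ‖T k u‖ - ρ ‖T k u₀‖ := fun k => by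
        refine le_trans ?_ (hρ.sub_ge (by linarith [hsig k]) (hbu k))
        rw [neg_le_neg_iff]
        refine mul_le_mul_of_nonneg_left ?_ (hρ.deriv_nonneg b hb)
        rw [hh, map_sub]
        exact abs_norm_sub_norm_le _ _
      have h6 : ∑ k, ‖T k h‖ ≤ √(Fintype.card ι) / √c₀ * δ := by
        have h7 := sq_sum_le_card_mul_sum_sq (s := Finset.univ) (f := fun k => ‖T k h‖)
        have h8 := hT.upper h
        have hc := hT.pos
        refine le_of_sq_le_sq ?_ (by positivity)
        rw [mul_pow, div_pow, Real.sq_sqrt (by positivity), Real.sq_sqrt hc.le]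
        calc _ ≤ _ := h7
          _ ≤ (Fintype.card ι : ℝ) * (c₀⁻¹ * ‖h‖ ^ 2) := by
            rw [Finset.card_univ]; gcongr
          _ = _ := by rw [heq]; ring
      calc ∑ k, (ρ ‖T k u‖ - ρ ‖T k u₀‖) ≥ ∑ k, -(deriv ρ b * ‖T k h‖) :=
            Finset.sum_le_sum fun k _ => h5 k
        _ = -(deriv ρ b * ∑ k, ‖T k h‖) := by rw [Finset.sum_neg_distrib, Finset.mul_sum]
        _ ≥ _ := by
            have := mul_le_mul_of_nonneg_left h6 (hρ.deriv_nonneg b hb)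
            linarith
    rw [Finset.sum_sub_distrib] at h4
    simp only [blockCriterion, h2, h3, norm_sub_sq_real] at h1
    have h5 := hz h
    have h6 := hT.lower h
    rw [heq] at h5 h6
    nlinarith
  refine ⟨u, hu', IsLocalMin.isBlockStationary hρ.diff (fun k => ?_) ?_⟩
  · exact norm_pos_iff.1 (lt_of_lt_of_le hb (hbu k))
  · exact hmin.isLocalMin (Metric.closedBall_mem_nhds_of_mem (by simpa [dist_eq_norm] using hlt))

/-- Sum over the blocks of the linearization bound, at a stationary point. -/
theorem IsBlockStationary.sub_ge_tangent (hT : BlockDesign T c₀) (hρ : PenaltyShape ρ b K)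
    {y : F} {u v : U} (s : IsBlockStationary T ρ y u) (hu : ∀ k, b ≤ ‖T k u‖)
    (hv : ∀ k, b ≤ ‖T k v‖) :
    inner ℝ (y - ∑ k, T k u) (∑ k, T k (v - u)) - K * (c₀⁻¹ * ‖v - u‖ ^ 2)
      ≤ ∑ k, ρ ‖T k v‖ - ∑ k, ρ ‖T k u‖ := by
  rw [s, ← Finset.sum_sub_distrib]
  have h1 := Finset.sum_le_sum fun k (_ : k ∈ Finset.univ) => hρ.norm_sub_ge_tangent (hu k) (hv k)
  have h2 := mul_le_mul_of_nonneg_left (hT.upper (v - u)) hρ.curv_nonneg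
  simp only [Finset.sum_sub_distrib, ← Finset.mul_sum, map_sub] at h1 h2 ⊢
  linarith

/-- Stationary points near the truth depend on the data in a Lipschitz way; in particular there is
at most one. -/
theorem BlockDesign.norm_sub_le_of_isBlockStationary (hT : BlockDesign T c₀)
    (hρ : PenaltyShape ρ b K) (hK : 4 * K ≤ c₀ ^ 2) (hsig : ∀ k, 2 * b ≤ ‖T k u₀‖)
    (hδ : δ ≤ √c₀ * b) {y₁ y₂ : F} {u₁ u₂ : U} (h₁ : ‖u₁ - u₀‖ ≤ δ) (h₂ : ‖u₂ - u₀‖ ≤ δ)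
    (s₁ : IsBlockStationary T ρ y₁ u₁) (s₂ : IsBlockStationary T ρ y₂ u₂) {L : ℝ} (hL0 : 0 ≤ L)
    (hL : ∀ h, inner ℝ (y₁ - y₂) (∑ k, T k h) ≤ L * ‖h‖) :
    c₀ / 2 * ‖u₁ - u₂‖ ≤ L := by
  have hb₁ := hT.le_norm_apply hsig hδ h₁
  have hb₂ := hT.le_norm_apply hsig hδ h₂
  have t₁ := s₁.sub_ge_tangent hT hρ hb₁ hb₂
  have t₂ := s₂.sub_ge_tangent hT hρ hb₂ hb₁
  have hc := hT.pos
  have h3 := hL (u₁ - u₂)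
  have h4 := hT.lower (u₁ - u₂)
  have h5 : K * (c₀⁻¹ * ‖u₁ - u₂‖ ^ 2) ≤ c₀ / 4 * ‖u₁ - u₂‖ ^ 2 := by
    rw [← mul_assoc]
    refine mul_le_mul_of_nonneg_right ?_ (sq_nonneg _)
    rw [← div_eq_mul_inv, div_le_iff₀ hc]; nlinarith
  have h6 : inner ℝ (y₁ - ∑ k, T k u₁) (∑ k, T k (u₂ - u₁))
      + inner ℝ (y₂ - ∑ k, T k u₂) (∑ k, T k (u₁ - u₂))
      = ‖∑ k, T k (u₁ - u₂)‖ ^ 2 - inner ℝ (y₁ - y₂) (∑ k, T k (u₁ - u₂)) := by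
    have e1 : ∑ k, T k (u₂ - u₁) = -∑ k, T k (u₁ - u₂) := by
      rw [← Finset.sum_neg_distrib]; simp
    have e2 : y₂ - ∑ k, T k u₂ = y₁ - ∑ k, T k u₁ + ∑ k, T k (u₁ - u₂) - (y₁ - y₂) := by
      simp only [map_sub, Finset.sum_sub_distrib]; abel
    rw [e1, e2, inner_neg_right, inner_sub_left _ (y₁ - y₂), inner_add_left,
      real_inner_self_eq_norm_sq]
    ring
  rw [norm_sub_rev u₂ u₁] at t₁
  rcases (norm_nonneg (u₁ - u₂)).eq_or_lt with h7 | h7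
  · rw [← h7]; simpa using hL0
  · refine le_of_mul_le_mul_right ?_ h7
    nlinarith

/-- A stationary point near the truth is a strict local minimizer of the full criterion, when the
residual is correlated with each noise direction `w j` less than the slope of the penalty at zero.
The noise directions are quantified through their images `w j` in the response space. -/
theorem IsBlockStationary.exists_strict_min {N : Type*} [Fintype N] (hT : BlockDesign T c₀)
    (hρ : PenaltyShape ρ b K) (hK : 4 * K < c₀ ^ 2) {y : F} {u : U}
    (s : IsBlockStationary T ρ y u) (hu : ∀ k, b < ‖T k u‖) {B : N → ℝ}
    (hB : ∀ j, ∃ t, 0 < t ∧ B j < deriv ρ t) :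
    ∃ r, 0 < r ∧ ∀ (v : U) (w : N → F), ‖v - u‖ < r → (∀ j, ‖w j‖ < r) →
      (∀ j, inner ℝ (y - ∑ k, T k u) (w j) ≤ B j * ‖w j‖) → (v ≠ u ∨ ∃ j, w j ≠ 0) →
      blockCriterion T ρ y u + ∑ _j : N, ρ 0
        < 1 / 2 * ‖y - (∑ k, T k v + ∑ j, w j)‖ ^ 2 + (∑ k, ρ ‖T k v‖ + ∑ j, ρ ‖w j‖) := by
  choose t ht hBt using hB
  have hc := hT.pos
  have e1 : ∀ᶠ r : ℝ in 𝓝[>] 0, 0 < r := self_mem_nhdsWithin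
  have e2 : ∀ᶠ r : ℝ in 𝓝[>] 0, ∀ j, r < t j :=
    eventually_all.2 fun j => nhdsWithin_le_nhds (eventually_lt_nhds (ht j))
  have e3 : ∀ᶠ r : ℝ in 𝓝[>] 0, ∀ j, Fintype.card N * r < deriv ρ (t j) - B j := by
    refine eventually_all.2 fun j => nhdsWithin_le_nhds ?_
    have : Tendsto (fun r : ℝ => Fintype.card N * r) (𝓝 0) (𝓝 0) := by
      simpa using (tendsto_id (α := ℝ) (x := 𝓝 0)).const_mul (Fintype.card N : ℝ)
    exact this.eventually_lt_const (sub_pos.2 (hBt j))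
  have e4 : ∀ᶠ r : ℝ in 𝓝[>] 0, ∀ k, r / √c₀ < ‖T k u‖ - b := by
    refine eventually_all.2 fun k => nhdsWithin_le_nhds ?_
    have : Tendsto (fun r : ℝ => r / √c₀) (𝓝 0) (𝓝 0) := by
      simpa using (tendsto_id (α := ℝ) (x := 𝓝 0)).div_const (√c₀)
    exact this.eventually_lt_const (sub_pos.2 (hu k))
  -- the radius keeps the signal blocks beyond `b`, the noise blocks where the slope of the penalty
  -- exceeds `B j`, and the quadratic term of the noise blocks below the gap between the two
  obtain ⟨r, hr0, hrt, hrB, hrT⟩ := (e1.and (e2.and (e3.and e4))).exists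
  refine ⟨r, hr0, fun v w hv hw hcor hne => ?_⟩
  set W := ∑ j, w j with hW
  set h := v - u with hh
  have hbv : ∀ k, b ≤ ‖T k v‖ := fun k => by
    have h1 : ‖T k u‖ ≤ ‖T k v‖ + ‖T k h‖ := by
      rw [hh, map_sub, norm_sub_rev]; exact norm_le_insert' _ _
    have h2 := hT.norm_apply_le h k
    have h3 : ‖h‖ / √c₀ ≤ r / √c₀ := by gcongr
    linarith [hrT k]
  have t1 := s.sub_ge_tangent hT hρ (fun k => (hu k).le) hbv
  set R := y - ∑ k, T k u with hR
  have t2 : y - (∑ k, T k v + W) = R - (∑ k, T k h + W) := by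
    simp only [hR, hh, map_sub, Finset.sum_sub_distrib]; abel
  have hW1 : ‖W‖ ≤ ∑ j, ‖w j‖ := norm_sum_le _ _
  have hW2 : ∑ j, ‖w j‖ ≤ Fintype.card N * r := by
    calc _ ≤ ∑ _j : N, r := Finset.sum_le_sum fun j _ => (hw j).le
      _ = _ := by simp
  have hW0 : 0 ≤ ∑ j, ‖w j‖ := Finset.sum_nonneg fun j _ => norm_nonneg _
  have hW3 : ‖W‖ ^ 2 ≤ Fintype.card N * r * ∑ j, ‖w j‖ := by
    nlinarith [norm_nonneg W]
  have hcor' : inner ℝ R W ≤ ∑ j, B j * ‖w j‖ := by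
    rw [hW, inner_sum]; exact Finset.sum_le_sum fun j _ => hcor j
  have hpen : ∑ j, deriv ρ (t j) * ‖w j‖ ≤ ∑ j, ρ ‖w j‖ - ∑ _j : N, ρ 0 := by
    rw [← Finset.sum_sub_distrib]
    exact Finset.sum_le_sum fun j _ =>
      hρ.sub_zero_ge (norm_nonneg _) (ht j) ((hw j).le.trans (hrt j).le)
  have hquad : ‖∑ k, T k h‖ ^ 2 ≤ 2 * ‖∑ k, T k h + W‖ ^ 2 + 2 * ‖W‖ ^ 2 := by
    have h1 : ‖∑ k, T k h‖ ≤ ‖∑ k, T k h + W‖ + ‖W‖ := by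
      simpa using norm_sub_le (∑ k, T k h + W) W
    nlinarith [norm_nonneg (∑ k, T k h), sq_nonneg (‖∑ k, T k h + W‖ - ‖W‖)]
  have hlow := hT.lower h
  have hKc : K * (c₀⁻¹ * ‖h‖ ^ 2) = K / c₀ * ‖h‖ ^ 2 := by ring
  have hKc' : K / c₀ < c₀ / 4 := by
    rw [div_lt_iff₀ hc]; nlinarith
  rw [t2, norm_sub_sq_real, inner_add_right, blockCriterion]
  rw [hKc] at t1
  have hgap : ∑ j, (deriv ρ (t j) - B j - Fintype.card N * r) * ‖w j‖
      = ∑ j, deriv ρ (t j) * ‖w j‖ - ∑ j, B j * ‖w j‖ - Fintype.card N * r * ∑ j, ‖w j‖ := by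
    rw [Finset.mul_sum, ← Finset.sum_sub_distrib, ← Finset.sum_sub_distrib]
    exact Finset.sum_congr rfl fun j _ => by ring
  have hgap0 : ∀ j ∈ Finset.univ, 0 ≤ (deriv ρ (t j) - B j - Fintype.card N * r) * ‖w j‖ :=
    fun j _ => mul_nonneg (by linarith [hrB j]) (norm_nonneg _)
  have hpos : 0 < (c₀ / 4 - K / c₀) * ‖h‖ ^ 2
      + ∑ j, (deriv ρ (t j) - B j - Fintype.card N * r) * ‖w j‖ := by
    rcases hne with hne | ⟨j, hj⟩
    · have : 0 < ‖h‖ := norm_pos_iff.2 (sub_ne_zero.2 hne)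
      have h1 : 0 < (c₀ / 4 - K / c₀) * ‖h‖ ^ 2 := by
        have : 0 < c₀ / 4 - K / c₀ := by linarith
        positivity
      linarith [Finset.sum_nonneg hgap0]
    · have h1 : 0 < ∑ j, (deriv ρ (t j) - B j - Fintype.card N * r) * ‖w j‖ := by
        refine Finset.sum_pos' hgap0 ⟨j, Finset.mem_univ j, mul_pos ?_ (norm_pos_iff.2 hj)⟩
        linarith [hrB j]
      have h2 : 0 ≤ (c₀ / 4 - K / c₀) * ‖h‖ ^ 2 :=
        mul_nonneg (by linarith) (sq_nonneg _)
      linarith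
  nlinarith

/-- The gradient of the penalty is Lipschitz near the truth: the norm of each block moves little,
and so does its direction, since the block is bounded away from zero. -/
theorem BlockDesign.abs_sum_deriv_sub_le (hT : BlockDesign T c₀) (hρ : PenaltyShape ρ b K)
    (hsig : ∀ k, 2 * b ≤ ‖T k u₀‖) {u : U} (hu : ∀ k, b ≤ ‖T k u‖) (h : U) :
    |∑ k, deriv ρ ‖T k u₀‖ * (inner ℝ (T k u₀) (T k h) / ‖T k u₀‖)
      - ∑ k, deriv ρ ‖T k u‖ * (inner ℝ (T k u) (T k h) / ‖T k u‖)|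
      ≤ (K + deriv ρ b / b) * (c₀⁻¹ * (‖u - u₀‖ * ‖h‖)) := by
  have hb := hρ.pos
  have hc := hT.pos
  have hd := hρ.deriv_nonneg b hb
  have hblock : ∀ x x₀ w : F, b ≤ ‖x‖ → 2 * b ≤ ‖x₀‖ →
      |deriv ρ ‖x₀‖ * (inner ℝ x₀ w / ‖x₀‖) - deriv ρ ‖x‖ * (inner ℝ x w / ‖x‖)|
        ≤ (K + deriv ρ b / b) * (‖x - x₀‖ * ‖w‖) := by
    intro x x₀ w hx hx₀
    have hxp : 0 < ‖x‖ := by linarith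
    have hxp₀ : 0 < ‖x₀‖ := by linarith
    -- the difference of the radial factors, and `deriv ρ ‖x₀‖` times that of the directions
    have e1 : deriv ρ ‖x₀‖ * (inner ℝ x₀ w / ‖x₀‖) - deriv ρ ‖x‖ * (inner ℝ x w / ‖x‖)
        = (deriv ρ ‖x₀‖ - deriv ρ ‖x‖) * (inner ℝ x w / ‖x‖)
          + deriv ρ ‖x₀‖ * ((inner ℝ (x₀ - x) w + inner ℝ x w * ((‖x‖ - ‖x₀‖) / ‖x‖)) / ‖x₀‖) := by
      rw [inner_sub_left]; field_simp; ring
    have h1 : |inner ℝ x w / ‖x‖| ≤ ‖w‖ := by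
      rw [abs_div, abs_of_pos hxp, div_le_iff₀ hxp, mul_comm]
      exact abs_real_inner_le_norm x w
    have h2 : |deriv ρ ‖x₀‖ - deriv ρ ‖x‖| ≤ K * ‖x - x₀‖ :=
      (hρ.deriv_lipschitz hx (by linarith)).trans <| by
        refine mul_le_mul_of_nonneg_left ?_ hρ.curv_nonneg
        rw [abs_sub_comm]; exact abs_norm_sub_norm_le _ _
    have h3 : |inner ℝ (x₀ - x) w + inner ℝ x w * ((‖x‖ - ‖x₀‖) / ‖x‖)|
        ≤ 2 * (‖x - x₀‖ * ‖w‖) := by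
      refine (abs_add_le _ _).trans ?_
      have h4 : |inner ℝ (x₀ - x) w| ≤ ‖x - x₀‖ * ‖w‖ := by
        rw [norm_sub_rev]; exact abs_real_inner_le_norm _ _
      have h5 : |inner ℝ x w * ((‖x‖ - ‖x₀‖) / ‖x‖)| ≤ ‖x - x₀‖ * ‖w‖ := by
        rw [mul_div_assoc', mul_comm (inner ℝ x w), ← mul_div_assoc', abs_mul]
        exact mul_le_mul (abs_norm_sub_norm_le _ _) h1 (abs_nonneg _) (norm_nonneg _)
      linarith
    have h6 : deriv ρ ‖x₀‖ ≤ deriv ρ b := hρ.deriv_le (by linarith)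
    have h7 := hρ.deriv_nonneg _ hxp₀
    rw [e1]
    refine (abs_add_le _ _).trans ?_
    rw [abs_mul, abs_mul, abs_of_nonneg h7, add_mul,
      abs_div (inner ℝ (x₀ - x) w + _), abs_of_pos hxp₀]
    refine add_le_add ?_ ?_
    · rw [← mul_assoc]
      exact mul_le_mul h2 h1 (abs_nonneg _) (mul_nonneg hρ.curv_nonneg (norm_nonneg _))
    · calc _ ≤ deriv ρ b * (2 * (‖x - x₀‖ * ‖w‖) / (2 * b)) := by gcongr
        _ = _ := by field_simp
  have hCS : ∑ k, ‖T k u - T k u₀‖ * ‖T k h‖ ≤ c₀⁻¹ * (‖u - u₀‖ * ‖h‖) := by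
    have h1 := Finset.sum_mul_sq_le_sq_mul_sq Finset.univ (fun k => ‖T k u - T k u₀‖)
      (fun k => ‖T k h‖)
    have h2 := hT.upper (u - u₀)
    have h3 := hT.upper h
    simp only [map_sub] at h2
    refine le_of_sq_le_sq (h1.trans ?_) (by positivity)
    calc _ ≤ (c₀⁻¹ * ‖u - u₀‖ ^ 2) * (c₀⁻¹ * ‖h‖ ^ 2) :=
          mul_le_mul h2 h3 (by positivity) (by positivity)
      _ = _ := by ring
  rw [← Finset.sum_sub_distrib]
  refine (Finset.abs_sum_le_sum_abs _ _).trans ?_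
  calc _ ≤ ∑ k, (K + deriv ρ b / b) * (‖T k u - T k u₀‖ * ‖T k h‖) :=
        Finset.sum_le_sum fun k _ => hblock _ _ _ (hu k) (hsig k)
    _ = (K + deriv ρ b / b) * ∑ k, ‖T k u - T k u₀‖ * ‖T k h‖ := by rw [Finset.mul_sum]
    _ ≤ _ := mul_le_mul_of_nonneg_left hCS (add_nonneg hρ.curv_nonneg (by positivity))

end Optimisation

/-! ### Gaussian noise -/

section Gaussian

variable {ι Ω : Type*} [Fintype ι] [MeasurableSpace Ω] {P : Measure Ω} {X : ι → Ω → ℝ} {σ : ℝ≥0}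

theorem hasLaw_dotProduct_gaussianReal (hind : iIndepFun X P)
    (hlaw : ∀ i, HasLaw (X i) (gaussianReal 0 (σ ^ 2)) P) (a : ι → ℝ) {v : ℝ≥0}
    (hv : (v : ℝ) = σ ^ 2 * (a ⬝ᵥ a)) :
    HasLaw (fun ω => a ⬝ᵥ fun i => X i ω) (gaussianReal 0 v) P := by
  classical
  have := hind.isProbabilityMeasure
  have hm : ∀ i, HasLaw (fun ω => a i * X i ω)
      (gaussianReal 0 (.mk (a i ^ 2) (sq_nonneg _) * σ ^ 2)) P :=
    fun i => by simpa using gaussianReal_const_mul (hlaw i) (a i)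
  have hind' : iIndepFun (fun i ω => a i * X i ω) P :=
    hind.comp (fun i x => a i * x) fun i => measurable_const_mul (a i)
  have key : ∀ s : Finset ι, P.map (∑ i ∈ s, fun ω => a i * X i ω)
      = gaussianReal 0 (∑ i ∈ s, .mk (a i ^ 2) (sq_nonneg _) * σ ^ 2) := by
    intro s
    induction s using Finset.induction_on with
    | empty =>
      simp only [Finset.sum_empty, gaussianReal_zero_var]
      rw [show (0 : Ω → ℝ) = fun _ => 0 from rfl, Measure.map_const]
      simp
    | insert i s hi ih =>
      rw [Finset.sum_insert hi, Finset.sum_insert hi]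
      have := gaussianReal_add_gaussianReal_of_indepFun
        (hind'.indepFun_finsetSum_of_notMem₀ (fun j => (hm j).aemeasurable) hi).symm
        (hm i).map_eq ih
      simpa using this
  have hv' : v = ∑ i, .mk (a i ^ 2) (sq_nonneg _) * σ ^ 2 := by
    apply NNReal.coe_injective
    rw [hv]
    simp only [dotProduct, Finset.mul_sum, NNReal.coe_sum, NNReal.coe_mul, NNReal.coe_mk,
      NNReal.coe_pow]
    exact Finset.sum_congr rfl fun i _ => by ring
  have hfun : (fun ω => a ⬝ᵥ fun i => X i ω) = ∑ i, fun ω => a i * X i ω := by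
    ext ω; simp [dotProduct]
  rw [hfun, hv']
  exact ⟨Finset.aemeasurable_sum _ fun i _ => (hm i).aemeasurable, key _⟩

theorem lintegral_exp_dotProduct (hind : iIndepFun X P)
    (hlaw : ∀ i, HasLaw (X i) (gaussianReal 0 (σ ^ 2)) P) (a : ι → ℝ) :
    ∫⁻ ω, ENNReal.ofReal (Real.exp (a ⬝ᵥ fun i => X i ω)) ∂P
      = ENNReal.ofReal (Real.exp (σ ^ 2 * (a ⬝ᵥ a) / 2)) := by
  have h0 : 0 ≤ (σ : ℝ) ^ 2 * (a ⬝ᵥ a) :=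
    mul_nonneg (sq_nonneg _) (Finset.sum_nonneg fun i _ => mul_self_nonneg _)
  obtain ⟨v, hv⟩ : ∃ v : ℝ≥0, (v : ℝ) = σ ^ 2 * (a ⬝ᵥ a) := ⟨⟨_, h0⟩, rfl⟩
  have h := hasLaw_dotProduct_gaussianReal hind hlaw a hv
  rw [← lintegral_map' (μ := P) (f := fun x => ENNReal.ofReal (Real.exp x)) (by fun_prop)
    h.aemeasurable, h.map_eq, ← ofReal_integral_eq_lintegral_ofReal]
  · have := mgf_gaussianReal (p := gaussianReal 0 v) (X := id) Measure.map_id 1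
    simp only [mgf, id, one_mul] at this
    rw [this, hv]; simp
  · simpa using integrable_exp_mul_gaussianReal (μ := 0) (v := v) 1
  · exact ae_of_all _ fun x => (Real.exp_pos x).le

theorem lintegral_sq_dotProduct (hind : iIndepFun X P)
    (hlaw : ∀ i, HasLaw (X i) (gaussianReal 0 (σ ^ 2)) P) (a : ι → ℝ) :
    ∫⁻ ω, ENNReal.ofReal ((a ⬝ᵥ fun i => X i ω) ^ 2) ∂P = ENNReal.ofReal (σ ^ 2 * (a ⬝ᵥ a)) := by
  have h0 : 0 ≤ (σ : ℝ) ^ 2 * (a ⬝ᵥ a) :=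
    mul_nonneg (sq_nonneg _) (Finset.sum_nonneg fun i _ => mul_self_nonneg _)
  obtain ⟨v, hv⟩ : ∃ v : ℝ≥0, (v : ℝ) = σ ^ 2 * (a ⬝ᵥ a) := ⟨⟨_, h0⟩, rfl⟩
  have h := hasLaw_dotProduct_gaussianReal hind hlaw a hv
  rw [← lintegral_map' (μ := P) (f := fun x => ENNReal.ofReal (x ^ 2)) (by fun_prop)
    h.aemeasurable, h.map_eq, ← ofReal_integral_eq_lintegral_ofReal]
  · have h1 := variance_fun_id_gaussianReal (μ := 0) (v := v)
    rw [variance_of_integral_eq_zero (by fun_prop) (by simp)] at h1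
    rw [h1, hv]
  · exact (memLp_id_gaussianReal (μ := 0) (v := v) 2).integrable_sq
  · exact ae_of_all _ fun x => sq_nonneg x

theorem lintegral_exp_sq_gaussianReal_le :
    ∫⁻ x, ENNReal.ofReal (Real.exp (x ^ 2 / 4)) ∂gaussianReal 0 1
      ≤ ENNReal.ofReal (Real.exp 1) := by
  rw [gaussianReal_of_var_ne_zero _ one_ne_zero,
    lintegral_withDensity_eq_lintegral_mul _ (measurable_gaussianPDF 0 1) (by fun_prop)]
  have h1 : ∀ x : ℝ, (gaussianPDF 0 1 * fun x => ENNReal.ofReal (Real.exp (x ^ 2 / 4))) x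
      = ENNReal.ofReal ((√(2 * Real.pi))⁻¹ * Real.exp (-(1 / 4) * x ^ 2)) := fun x => by
    rw [Pi.mul_apply, gaussianPDF, ← ENNReal.ofReal_mul (gaussianPDFReal_nonneg _ _ _),
      gaussianPDFReal, mul_assoc, ← Real.exp_add]
    simp only [NNReal.coe_one, mul_one, sub_zero]
    ring_nf
  simp_rw [h1]
  rw [← ofReal_integral_eq_lintegral_ofReal
    ((integrable_exp_neg_mul_sq (by norm_num)).const_mul _) (ae_of_all _ fun x => by positivity),
    integral_const_mul, integral_gaussian]
  refine ENNReal.ofReal_le_ofReal ?_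
  have h2 : √(Real.pi / (1 / 4)) = √2 * √(2 * Real.pi) := by
    rw [← Real.sqrt_mul (by norm_num)]; ring_nf
  have h3 : √(2 * Real.pi) ≠ 0 := (Real.sqrt_pos.2 (by positivity)).ne'
  rw [h2, mul_comm (√2), ← mul_assoc, inv_mul_cancel₀ h3, one_mul]
  have h4 : √2 ≤ 2 := Real.sqrt_le_iff.2 (by norm_num)
  linarith [Real.add_one_le_exp 1]

/-- Exponential moment of a quadratic form in Gaussian noise. The square is linearized by an
auxiliary standard Gaussian vector `g`, through `exp (|x|² / 2) = E exp ⟨g, x⟩`; the bound depends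
only on the number of rows of `B`, since its transpose is a contraction. -/
theorem lintegral_exp_sq_mulVec_le {κ : Type*} [Fintype κ] (hind : iIndepFun X P)
    (hlaw : ∀ i, HasLaw (X i) (gaussianReal 0 (σ ^ 2)) P) (B : Matrix κ ι ℝ)
    (hB : ∀ g : κ → ℝ, (g ᵥ* B) ⬝ᵥ (g ᵥ* B) ≤ g ⬝ᵥ g) :
    ∫⁻ ω, ENNReal.ofReal (Real.exp (((B *ᵥ fun i => X i ω) ⬝ᵥ (B *ᵥ fun i => X i ω))
      / (4 * (σ ^ 2 + 1)))) ∂P ≤ ENNReal.ofReal (Real.exp (Fintype.card κ)) := by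
  have := hind.isProbabilityMeasure
  set s : ℝ := √(1 / (2 * (σ ^ 2 + 1))) with hs
  have hs2 : s * s = 1 / (2 * (σ ^ 2 + 1)) := Real.mul_self_sqrt (by positivity)
  set ν : Measure (κ → ℝ) := Measure.pi fun _ => gaussianReal 0 1 with hν
  have hindν : iIndepFun (fun (k : κ) (g : κ → ℝ) => g k) ν :=
    iIndepFun_pi (X := fun (_ : κ) (x : ℝ) => x) fun _ => aemeasurable_id
  have hlawν : ∀ k, HasLaw (fun g : κ → ℝ => g k) (gaussianReal 0 ((1 : ℝ≥0) ^ 2)) ν := fun k => by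
    rw [one_pow]
    exact ⟨(measurable_pi_apply k).aemeasurable, (measurePreserving_eval _ k).map_eq⟩
  have hX : ∀ i, AEMeasurable (X i) P := fun i => (hlaw i).aemeasurable
  have h1 : ∀ x : κ → ℝ, ENNReal.ofReal (Real.exp ((x ⬝ᵥ x) / (4 * (σ ^ 2 + 1))))
      = ∫⁻ g, ENNReal.ofReal (Real.exp ((s • x) ⬝ᵥ g)) ∂ν := fun x => by
    rw [lintegral_exp_dotProduct hindν hlawν (s • x)]
    simp only [smul_dotProduct, dotProduct_smul, smul_eq_mul, ← mul_assoc, hs2]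
    congr 2
    simp only [NNReal.coe_one]
    field_simp
    norm_num
  have h2 : ∀ g : κ → ℝ, ∫⁻ ω, ENNReal.ofReal (Real.exp ((s • (B *ᵥ fun i => X i ω)) ⬝ᵥ g)) ∂P
      ≤ ∏ k, ENNReal.ofReal (Real.exp (g k ^ 2 / 4)) := fun g => by
    have h3 : ∀ ω, (s • (B *ᵥ fun i => X i ω)) ⬝ᵥ g
        = (s • (g ᵥ* B)) ⬝ᵥ fun i => X i ω := fun ω => by
      rw [smul_dotProduct, smul_dotProduct, ← dotProduct_mulVec, dotProduct_comm]
    simp_rw [h3]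
    rw [lintegral_exp_dotProduct hind hlaw, ← ENNReal.ofReal_prod_of_nonneg
      (fun k _ => (Real.exp_pos _).le), ← Real.exp_sum]
    refine ENNReal.ofReal_le_ofReal (Real.exp_le_exp.2 ?_)
    have h4 : ∑ k, g k ^ 2 / 4 = (g ⬝ᵥ g) / 4 := by
      simp [dotProduct, Finset.sum_div, sq]
    rw [h4]
    simp only [smul_dotProduct, dotProduct_smul, smul_eq_mul]
    rw [← mul_assoc s s, hs2]
    have h5 := hB g
    have h6 : 0 ≤ (g ᵥ* B) ⬝ᵥ (g ᵥ* B) := Finset.sum_nonneg fun i _ => mul_self_nonneg _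
    have h7 : (σ : ℝ) ^ 2 * (1 / (2 * (σ ^ 2 + 1))) ≤ 1 / 2 := by
      rw [mul_one_div, div_le_div_iff₀ (by positivity) (by norm_num)]; nlinarith
    nlinarith
  simp_rw [h1]
  rw [lintegral_lintegral_swap]
  · calc _ ≤ ∫⁻ g, ∏ k, ENNReal.ofReal (Real.exp (g k ^ 2 / 4)) ∂ν := lintegral_mono h2
      _ = ∏ k : κ, ∫⁻ g, ENNReal.ofReal (Real.exp (g k ^ 2 / 4)) ∂ν := by
        refine lintegral_prod_eq_prod_lintegral_of_indepFun Finset.univ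
          (fun k (g : κ → ℝ) => ENNReal.ofReal (Real.exp (g k ^ 2 / 4))) ?_ fun k => by fun_prop
        exact hindν.comp (fun _ x => ENNReal.ofReal (Real.exp (x ^ 2 / 4))) fun k => by fun_prop
      _ ≤ ∏ _k : κ, ENNReal.ofReal (Real.exp 1) := by
        refine Finset.prod_le_prod' fun k _ => ?_
        refine le_trans (le_of_eq ?_) lintegral_exp_sq_gaussianReal_le
        rw [← (measurePreserving_eval (fun _ : κ => gaussianReal 0 1) k).map_eq,
          lintegral_map (by fun_prop) (measurable_pi_apply k)]
      _ = _ := by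
        rw [Finset.prod_const, Finset.card_univ, ← ENNReal.ofReal_pow (Real.exp_pos _).le,
          ← Real.exp_nat_mul, mul_one]
  · have : AEMeasurable (fun z : Ω × (κ → ℝ) => (B *ᵥ fun i => X i z.1)) (P.prod ν) := by
      refine aemeasurable_pi_lambda _ fun k => ?_
      simp only [mulVec, dotProduct]
      exact Finset.aemeasurable_fun_sum _ fun i _ => ((hX i).comp_fst).const_mul _
    have h8 : AEMeasurable (fun z : Ω × (κ → ℝ) => (s • (B *ᵥ fun i => X i z.1)) ⬝ᵥ z.2)
        (P.prod ν) := by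
      simp only [dotProduct, Pi.smul_apply, smul_eq_mul]
      refine Finset.aemeasurable_fun_sum _ fun k _ => AEMeasurable.mul ?_ ?_
      · exact ((measurable_pi_apply k).comp_aemeasurable this).const_mul _
      · exact ((measurable_pi_apply k).comp measurable_snd).aemeasurable
    exact (Real.measurable_exp.comp_aemeasurable h8).ennreal_ofReal

/-- Exponential tail bound for the squared length of a contracted image of Gaussian noise. The scale
`σ² + 1` instead of `σ²` covers the degenerate case `σ = 0`. -/
theorem measure_sq_mulVec_ge_le {κ : Type*} [Fintype κ] (hind : iIndepFun X P)
    (hlaw : ∀ i, HasLaw (X i) (gaussianReal 0 (σ ^ 2)) P) (B : Matrix κ ι ℝ)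
    (hB : ∀ g : κ → ℝ, (g ᵥ* B) ⬝ᵥ (g ᵥ* B) ≤ g ⬝ᵥ g) (x : ℝ) :
    P {ω | 4 * (σ ^ 2 + 1) * x ≤ (B *ᵥ fun i => X i ω) ⬝ᵥ (B *ᵥ fun i => X i ω)}
      ≤ ENNReal.ofReal (Real.exp (Fintype.card κ - x)) := by
  have hX : ∀ i, AEMeasurable (X i) P := fun i => (hlaw i).aemeasurable
  have hm : AEMeasurable (fun ω => ENNReal.ofReal (Real.exp (((B *ᵥ fun i => X i ω) ⬝ᵥ
      (B *ᵥ fun i => X i ω)) / (4 * (σ ^ 2 + 1))))) P := by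
    have hX' : AEMeasurable (fun ω i => X i ω) P := aemeasurable_pi_lambda _ hX
    have hc : Measurable fun e : ι → ℝ => ENNReal.ofReal (Real.exp (((B *ᵥ e) ⬝ᵥ
      (B *ᵥ e)) / (4 * (σ ^ 2 + 1)))) :=
      ENNReal.measurable_ofReal.comp (Continuous.measurable (by fun_prop))
    exact hc.comp_aemeasurable hX'
  have h1 := mul_meas_ge_le_lintegral₀ hm (ENNReal.ofReal (Real.exp x))
  have h2 := h1.trans (lintegral_exp_sq_mulVec_le hind hlaw B hB)
  have h3 : {ω | 4 * (σ ^ 2 + 1) * x ≤ (B *ᵥ fun i => X i ω) ⬝ᵥ (B *ᵥ fun i => X i ω)} ⊆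
      {ω | ENNReal.ofReal (Real.exp x) ≤ ENNReal.ofReal (Real.exp (((B *ᵥ fun i => X i ω) ⬝ᵥ
      (B *ᵥ fun i => X i ω)) / (4 * (σ ^ 2 + 1))))} := fun ω hω => by
    refine ENNReal.ofReal_le_ofReal (Real.exp_le_exp.2 ?_)
    rw [le_div_iff₀ (by positivity), mul_comm]
    exact hω
  rw [Real.exp_sub, ENNReal.ofReal_div_of_pos (Real.exp_pos _)]
  refine (measure_mono h3).trans ?_
  rw [ENNReal.le_div_iff_mul_le (by left; simp [Real.exp_pos]) (by left; simp), mul_comm]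
  exact h2

/-- Chebyshev's bound for the squared length of a linear image of Gaussian noise. -/
theorem measure_sq_mulVec_ge_le_div {κ : Type*} [Fintype κ] (hind : iIndepFun X P)
    (hlaw : ∀ i, HasLaw (X i) (gaussianReal 0 (σ ^ 2)) P) (B : Matrix κ ι ℝ) {x : ℝ} (hx : 0 < x) :
    P {ω | x ≤ (B *ᵥ fun i => X i ω) ⬝ᵥ (B *ᵥ fun i => X i ω)}
      ≤ ENNReal.ofReal (σ ^ 2 * (∑ k, B k ⬝ᵥ B k) / x) := by
  have hX' : AEMeasurable (fun ω i => X i ω) P :=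
    aemeasurable_pi_lambda _ fun i => (hlaw i).aemeasurable
  have hm : AEMeasurable (fun ω => ENNReal.ofReal ((B *ᵥ fun i => X i ω) ⬝ᵥ
      (B *ᵥ fun i => X i ω))) P := by
    have hc : Measurable fun e : ι → ℝ => ENNReal.ofReal ((B *ᵥ e) ⬝ᵥ (B *ᵥ e)) :=
      ENNReal.measurable_ofReal.comp (Continuous.measurable (by fun_prop))
    exact hc.comp_aemeasurable hX'
  have h1 := mul_meas_ge_le_lintegral₀ hm (ENNReal.ofReal x)
  have h2 : ∫⁻ ω, ENNReal.ofReal ((B *ᵥ fun i => X i ω) ⬝ᵥ (B *ᵥ fun i => X i ω)) ∂P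
      = ENNReal.ofReal (σ ^ 2 * ∑ k, B k ⬝ᵥ B k) := by
    have h3 : ∀ ω, ENNReal.ofReal ((B *ᵥ fun i => X i ω) ⬝ᵥ (B *ᵥ fun i => X i ω))
        = ∑ k, ENNReal.ofReal ((B k ⬝ᵥ fun i => X i ω) ^ 2) := fun ω => by
      rw [← ENNReal.ofReal_sum_of_nonneg fun k _ => sq_nonneg _]
      simp [dotProduct, mulVec, sq]
    simp_rw [h3]
    rw [lintegral_finsetSum' _ fun k _ => ?_]
    · simp_rw [lintegral_sq_dotProduct hind hlaw]
      rw [← ENNReal.ofReal_sum_of_nonneg, Finset.mul_sum]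
      exact fun k _ => mul_nonneg (sq_nonneg _) (Finset.sum_nonneg fun i _ => mul_self_nonneg _)
    · have hc : Measurable fun e : ι → ℝ => ENNReal.ofReal ((B k ⬝ᵥ e) ^ 2) :=
      ENNReal.measurable_ofReal.comp (Continuous.measurable (by fun_prop))
      exact hc.comp_aemeasurable hX'
  rw [h2] at h1
  rw [ENNReal.ofReal_div_of_pos hx, ENNReal.le_div_iff_mul_le (by left; simp [hx]) (by left; simp),
    mul_comm]
  refine le_trans (mul_le_mul' le_rfl (measure_mono fun ω hω => ?_)) h1
  exact ENNReal.ofReal_le_ofReal hω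

end Gaussian

/-! ### Matrices and Euclidean norms -/

section MatrixTools

variable {ι κ : Type*} [Fintype ι] [Fintype κ]

theorem l2norm_sq (v : ι → ℝ) : l2norm v ^ 2 = v ⬝ᵥ v := by
  rw [l2norm, EuclideanSpace.real_norm_sq_eq]
  simp [dotProduct, sq]

theorem l2norm_nonneg (v : ι → ℝ) : 0 ≤ l2norm v := norm_nonneg _

theorem dotProduct_le_l2norm (v w : ι → ℝ) : v ⬝ᵥ w ≤ l2norm v * l2norm w := by
  have := real_inner_le_norm (WithLp.toLp 2 v) (WithLp.toLp 2 w)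
  rw [EuclideanSpace.inner_toLp_toLp] at this
  simpa [l2norm, dotProduct_comm] using this

theorem abs_dotProduct_le_l2norm (v w : ι → ℝ) : |v ⬝ᵥ w| ≤ l2norm v * l2norm w := by
  have := abs_real_inner_le_norm (WithLp.toLp 2 v) (WithLp.toLp 2 w)
  rw [EuclideanSpace.inner_toLp_toLp] at this
  simpa [l2norm, dotProduct_comm] using this

theorem l2norm_add_le (v w : ι → ℝ) : l2norm (v + w) ≤ l2norm v + l2norm w :=
  norm_add_le (WithLp.toLp 2 v) (WithLp.toLp 2 w)

theorem l2norm_smul (c : ℝ) (v : ι → ℝ) : l2norm (c • v) = |c| * l2norm v := by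
  rw [l2norm, WithLp.toLp_smul, norm_smul, Real.norm_eq_abs, l2norm]

theorem continuous_l2norm : Continuous (l2norm : (ι → ℝ) → ℝ) :=
  continuous_norm.comp (PiLp.continuous_toLp 2 _)

theorem l2norm_eq_zero {v : ι → ℝ} : l2norm v = 0 ↔ v = 0 := by
  rw [l2norm, norm_eq_zero, WithLp.toLp_eq_zero]

theorem mulVec_dotProduct_mulVec (A : Matrix ι κ ℝ) (x y : κ → ℝ) :
    (A *ᵥ x) ⬝ᵥ (A *ᵥ y) = x ⬝ᵥ ((Aᵀ * A) *ᵥ y) := by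
  rw [← mulVec_mulVec, dotProduct_mulVec x, vecMul_transpose]

theorem mulVec_dotProduct (A : Matrix ι κ ℝ) (x : κ → ℝ) (y : ι → ℝ) :
    (A *ᵥ x) ⬝ᵥ y = x ⬝ᵥ (Aᵀ *ᵥ y) := by
  rw [dotProduct_mulVec x, vecMul_transpose]

theorem dotProduct_mulVec_mem_Icc_of_spectrum_subset [DecidableEq κ] {A : Matrix κ κ ℝ}
    (hA : A.IsHermitian) {r s : ℝ} (h : spectrum ℝ A ⊆ Set.Icc r s) (x : κ → ℝ) :
    r * (x ⬝ᵥ x) ≤ x ⬝ᵥ (A *ᵥ x) ∧ x ⬝ᵥ (A *ᵥ x) ≤ s * (x ⬝ᵥ x) := by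
  have hscalar : ∀ t : ℝ, (algebraMap ℝ (Matrix κ κ ℝ) t).IsHermitian := fun t => by
    rw [Matrix.IsHermitian, algebraMap_eq_diagonal, diagonal_conjTranspose]; rfl
  have e : ∀ t : ℝ, algebraMap ℝ (Matrix κ κ ℝ) t *ᵥ x = t • x := fun t => by
    rw [Algebra.algebraMap_eq_smul_one, smul_mulVec, one_mulVec]
  constructor
  · have h1 : (A - algebraMap ℝ _ r).PosSemidef := by
      rw [posSemidef_iff_isHermitian_and_spectrum_nonneg]
      refine ⟨hA.sub (hscalar r), ?_⟩
      rw [← spectrum.sub_singleton_eq]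
      rintro _ ⟨y, hy, z, hz, rfl⟩
      rw [Set.mem_singleton_iff] at hz
      subst hz
      simpa using (h hy).1
    have h2 := h1.dotProduct_mulVec_nonneg x
    rw [sub_mulVec, e] at h2
    simp only [star_trivial, dotProduct_sub, dotProduct_smul, smul_eq_mul] at h2
    linarith
  · have h1 : (algebraMap ℝ _ s - A).PosSemidef := by
      rw [posSemidef_iff_isHermitian_and_spectrum_nonneg]
      refine ⟨(hscalar s).sub hA, ?_⟩
      rw [← spectrum.singleton_sub_eq]
      rintro _ ⟨y, hy, z, hz, rfl⟩
      rw [Set.mem_singleton_iff] at hy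
      subst hy
      simpa using (h hz).2
    have h2 := h1.dotProduct_mulVec_nonneg x
    rw [sub_mulVec, e] at h2
    simp only [star_trivial, dotProduct_sub, dotProduct_smul, smul_eq_mul] at h2
    linarith

section Whitening

theorem posSemidef_transpose_mul_self (A : Matrix ι κ ℝ) : (Aᵀ * A).PosSemidef := by
  simpa using posSemidef_conjTranspose_mul_self A

variable [DecidableEq κ] (A : Matrix ι κ ℝ)

theorem sqrt_gram_mul_self : CFC.sqrt (Aᵀ * A) * CFC.sqrt (Aᵀ * A) = Aᵀ * A :=
  CFC.sqrt_mul_sqrt_self _ (posSemidef_transpose_mul_self A).nonneg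

theorem transpose_sqrt_gram : (CFC.sqrt (Aᵀ * A))ᵀ = CFC.sqrt (Aᵀ * A) := by
  simpa using (CFC.sqrt_nonneg (Aᵀ * A)).posSemidef.isHermitian.eq

variable {A}

theorem isUnit_det_sqrt_gram (hA : IsUnit (Aᵀ * A)) : IsUnit (CFC.sqrt (Aᵀ * A)).det := by
  have h := (isUnit_iff_isUnit_det _).1 hA
  rw [← sqrt_gram_mul_self, det_mul] at h
  exact isUnit_of_mul_isUnit_left h

/-- The columns of `A (AᵀA)^{-1/2}` are orthonormal. -/
theorem whitened_transpose_mul_self (hA : IsUnit (Aᵀ * A)) :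
    (A * (CFC.sqrt (Aᵀ * A))⁻¹)ᵀ * (A * (CFC.sqrt (Aᵀ * A))⁻¹) = 1 := by
  have hS := isUnit_det_sqrt_gram hA
  rw [transpose_mul, transpose_nonsing_inv, transpose_sqrt_gram, Matrix.mul_assoc,
    ← Matrix.mul_assoc Aᵀ]
  nth_rw 2 [← sqrt_gram_mul_self]
  rw [← Matrix.mul_assoc, ← Matrix.mul_assoc, nonsing_inv_mul _ hS, Matrix.one_mul,
    mul_nonsing_inv _ hS]

theorem whitened_mul_transpose :
    (A * (CFC.sqrt (Aᵀ * A))⁻¹) * (A * (CFC.sqrt (Aᵀ * A))⁻¹)ᵀ = A * (Aᵀ * A)⁻¹ * Aᵀ := by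
  conv_rhs => rw [← sqrt_gram_mul_self, Matrix.mul_inv_rev]
  rw [transpose_mul, transpose_nonsing_inv, transpose_sqrt_gram]
  simp only [Matrix.mul_assoc]

end Whitening

section Isometry

variable [DecidableEq κ] {V : Matrix ι κ ℝ}

theorem l2norm_isometry_mulVec (hV : Vᵀ * V = 1) (x : κ → ℝ) : l2norm (V *ᵥ x) = l2norm x := by
  refine (sq_eq_sq₀ (l2norm_nonneg _) (l2norm_nonneg _)).1 ?_
  rw [l2norm_sq, l2norm_sq, mulVec_dotProduct_mulVec, hV, one_mulVec]

theorem l2norm_transpose_mulVec_le (hV : Vᵀ * V = 1) (x : ι → ℝ) : l2norm (Vᵀ *ᵥ x) ≤ l2norm x := by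
  have h1 : l2norm (Vᵀ *ᵥ x) ^ 2 ≤ l2norm (Vᵀ *ᵥ x) * l2norm x := by
    rw [l2norm_sq, ← mulVec_dotProduct]
    refine (dotProduct_le_l2norm _ _).trans ?_
    rw [l2norm_isometry_mulVec hV]
  rcases (l2norm_nonneg (Vᵀ *ᵥ x)).eq_or_lt with h | h
  · rw [← h]; exact l2norm_nonneg _
  · rw [sq] at h1; exact le_of_mul_le_mul_left h1 h

theorem l2norm_sub_proj_le [DecidableEq ι] (hV : Vᵀ * V = 1) (x : ι → ℝ) :
    l2norm ((1 - V * Vᵀ) *ᵥ x) ≤ l2norm x := by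
  refine le_of_sq_le_sq ?_ (l2norm_nonneg _)
  rw [l2norm_sq, l2norm_sq, sub_mulVec, one_mulVec, ← mulVec_mulVec]
  have h1 : (V *ᵥ (Vᵀ *ᵥ x)) ⬝ᵥ (V *ᵥ (Vᵀ *ᵥ x)) = (Vᵀ *ᵥ x) ⬝ᵥ (Vᵀ *ᵥ x) := by
    rw [mulVec_dotProduct_mulVec, hV, one_mulVec]
  have h2 : (V *ᵥ (Vᵀ *ᵥ x)) ⬝ᵥ x = (Vᵀ *ᵥ x) ⬝ᵥ (Vᵀ *ᵥ x) := mulVec_dotProduct _ _ _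
  have h3 : 0 ≤ (Vᵀ *ᵥ x) ⬝ᵥ (Vᵀ *ᵥ x) := by rw [← l2norm_sq]; positivity
  simp only [sub_dotProduct, dotProduct_sub]
  rw [dotProduct_comm x (V *ᵥ _), h1, h2]
  linarith

end Isometry

/-- The defining bound of the norm `‖B‖_{∞,2}`, with a bound for the sup norm of the vector. -/
theorem ofReal_l2norm_mulVec_le (B : Matrix ι κ ℝ) {x : κ → ℝ} {d : ℝ} (hx : ‖x‖ ≤ d) :
    ENNReal.ofReal (l2norm (B *ᵥ x)) ≤ ENNReal.ofReal d * norm_inf_two B := by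
  rcases (norm_nonneg x).eq_or_lt with h | h
  · rw [eq_comm, norm_eq_zero] at h
    have : l2norm (B *ᵥ x) = 0 := by rw [h, mulVec_zero]; exact l2norm_eq_zero.2 rfl
    rw [this]; simp
  · have h1 : ‖‖x‖⁻¹ • x‖ = 1 := by
      rw [norm_smul, norm_inv, norm_norm, inv_mul_cancel₀ h.ne']
    have h2 : l2norm (B *ᵥ x) = ‖x‖ * l2norm (B *ᵥ (‖x‖⁻¹ • x)) := by
      rw [mulVec_smul, l2norm_smul, abs_of_pos (inv_pos.2 h), ← mul_assoc, mul_inv_cancel₀ h.ne',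
        one_mul]
    rw [h2, ENNReal.ofReal_mul h.le]
    refine mul_le_mul' (ENNReal.ofReal_le_ofReal hx) ?_
    exact le_iSup₂ (f := fun (x : κ → ℝ) (_ : ‖x‖ = 1) => ENNReal.ofReal (l2norm (B *ᵥ x))) _ h1

end MatrixTools

/-! ### Truncation error and normalized blocks -/

namespace LinearFAR

variable (D : LinearFAR) (n : ℕ)

/-- The true coefficients of the signal blocks, stacked. -/
noncomputable def trueCoef : D.M0 n × Fin (D.q n) → ℝ := fun k => D.eta0 n k.1 k.2

/-- The part of the signal that the first `q_n` basis functions do not capture. -/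
noncomputable def approxError : Fin n → ℝ :=
  D.response n 0 - D.ThetaM0 n *ᵥ D.trueCoef n

theorem response_eq (e : Fin n → ℝ) :
    D.response n e = D.ThetaM0 n *ᵥ D.trueCoef n + (D.approxError n + e) := by
  ext i
  simp [approxError, response]
  ring

theorem integral_mul_eq_inner (f g : L2I) :
    ∫ t in Set.Icc (0 : ℝ) 1, f t * g t = inner ℝ f g := by
  rw [L2.inner_def]
  exact integral_congr_ae (ae_of_all _ fun t => by simp [mul_comm])

theorem ThetaM0_mulVec (u : D.M0 n × Fin (D.q n) → ℝ) :
    D.ThetaM0 n *ᵥ u = ∑ k : D.M0 n, D.Theta n k *ᵥ fun l => u (k, l) := by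
  ext i
  simp [ThetaM0, mulVec, dotProduct, Fintype.sum_prod_type]

/-- Truncation error of a basis expansion in `L²`, for an element of a Sobolev ellipsoid. -/
theorem abs_inner_sub_sum_le (b : HilbertBasis ℕ ℝ L2I) {f g : L2I} {C : ℝ} (hC : 0 ≤ C) {q : ℕ}
    (hq : 0 < q) (hs : Summable fun l : ℕ => (inner ℝ (b l) g) ^ 2 * ((l : ℝ) + 1) ^ 4)
    (hle : ∑' l : ℕ, (inner ℝ (b l) g) ^ 2 * ((l : ℝ) + 1) ^ 4 ≤ C ^ 2) :
    |inner ℝ f g - ∑ l : Fin q, inner ℝ (b l) g * inner ℝ (b l) f|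
      ≤ ‖f‖ * (C * ((q : ℝ) ^ 2)⁻¹) := by
  set g' : L2I := g - ∑ l ∈ Finset.range q, (inner ℝ (b l) g : ℝ) • b l with hg'
  have h1 : inner ℝ f g - ∑ l : Fin q, inner ℝ (b l) g * inner ℝ (b l) f = inner ℝ f g' := by
    rw [hg', inner_sub_right, inner_sum,
      Fin.sum_univ_eq_sum_range (fun l => inner ℝ (b l) g * inner ℝ (b l) f) q]
    congr 1
    exact Finset.sum_congr rfl fun l _ => by rw [inner_smul_right, real_inner_comm f]
  have hcoef : ∀ m, inner ℝ (b m) g' = if m < q then 0 else inner ℝ (b m) g := fun m => by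
    have ho := b.orthonormal
    rw [orthonormal_iff_ite] at ho
    rw [hg', inner_sub_right, inner_sum]
    simp only [inner_smul_right, ho, mul_ite, mul_one, mul_zero, Finset.sum_ite_eq,
      Finset.mem_range]
    split_ifs <;> simp
  have h2 : ‖g'‖ ^ 2 ≤ (C * ((q : ℝ) ^ 2)⁻¹) ^ 2 := by
    have h3 := b.hasSum_inner_mul_inner g' g'
    rw [real_inner_self_eq_norm_sq] at h3
    have h4 := hs.mul_left (((q : ℝ) ^ 4)⁻¹)
    have hq' : (0 : ℝ) < q := by exact_mod_cast hq
    have h5 : ‖g'‖ ^ 2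
        ≤ ∑' l : ℕ, ((q : ℝ) ^ 4)⁻¹ * ((inner ℝ (b l) g) ^ 2 * ((l : ℝ) + 1) ^ 4) := by
      rw [← h3.tsum_eq]
      refine h3.summable.tsum_le_tsum (fun l => ?_) h4
      rw [real_inner_comm, hcoef]
      split_ifs with hl
      · simp only [mul_zero]; positivity
      · have h6 : (q : ℝ) ≤ l + 1 := by
          have : (q : ℝ) ≤ l := by exact_mod_cast not_lt.1 hl
          linarith
        have h7 : (q : ℝ) ^ 4 ≤ ((l : ℝ) + 1) ^ 4 := by gcongr
        calc inner ℝ (b l) g * inner ℝ (b l) g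
            = ((q : ℝ) ^ 4)⁻¹ * ((inner ℝ (b l) g) ^ 2 * (q : ℝ) ^ 4) := by field_simp
          _ ≤ _ := by gcongr
    rw [tsum_mul_left] at h5
    calc _ ≤ _ := h5
      _ ≤ ((q : ℝ) ^ 4)⁻¹ * C ^ 2 := by gcongr
      _ = _ := by rw [mul_pow, inv_pow]; ring
  rw [h1]
  refine (abs_real_inner_le_norm f g').trans ?_
  exact mul_le_mul_of_nonneg_left (le_of_sq_le_sq h2 (by positivity)) (norm_nonneg f)

variable {D}

theorem BasisCondition.exists_l2norm_approxError_le (h : D.BasisCondition) :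
    ∃ C : ℝ, 0 ≤ C ∧ ∀ n, 0 < D.q n →
      (∀ (j : Fin (D.p n)) (l : Fin (D.q n)), D.scale n j l ≠ 0) →
      l2norm (D.approxError n) ≤ √n * (C * ((D.s n : ℝ) * ((D.q n : ℝ) ^ 2)⁻¹)) := by
  obtain ⟨C, hC⟩ := h.sobolev
  obtain ⟨C', hC'⟩ := h.beta_bdd
  refine ⟨√|C'| * |C|, by positivity, fun n hq hsc => ?_⟩
  have hcoord : ∀ i, |D.approxError n i| ≤ √|C'| * |C| * ((D.s n : ℝ) * ((D.q n : ℝ) ^ 2)⁻¹) := by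
    intro i
    have e1 : D.approxError n i = ∑ k : D.M0 n, (inner ℝ (D.beta n k) (D.X n i k)
        - ∑ l : Fin (D.q n), inner ℝ (D.b l) (D.X n i k) * inner ℝ (D.b l) (D.beta n k)) := by
      have e2 : D.response n 0 i = ∑ k : D.M0 n, inner ℝ (D.beta n k) (D.X n i k) := by
        simp only [response, integral_mul_eq_inner, Pi.zero_apply, add_zero]
        rw [Finset.sum_coe_sort (D.M0 n) (fun j => inner ℝ (D.beta n j) (D.X n i j))]
        symm
        refine Finset.sum_subset (Finset.subset_univ _) fun j _ hj => ?_
        have : D.beta n j = 0 := by simpa [M0] using hj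
        rw [this, inner_zero_left]
      rw [approxError, Pi.sub_apply, e2, ThetaM0_mulVec, Finset.sum_apply, ← Finset.sum_sub_distrib]
      refine Finset.sum_congr rfl fun k _ => ?_
      congr 1
      simp only [mulVec, dotProduct, Theta, of_apply, trueCoef, eta0, theta]
      refine Finset.sum_congr rfl fun l _ => ?_
      have := hsc k l
      field_simp
    rw [e1]
    refine (Finset.abs_sum_le_sum_abs _ _).trans ?_
    calc _ ≤ ∑ _k : D.M0 n, √|C'| * (|C| * ((D.q n : ℝ) ^ 2)⁻¹) := by
          refine Finset.sum_le_sum fun k _ => ?_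
          have h1 := hC n i k
          refine (abs_inner_sub_sum_le D.b (abs_nonneg C) hq h1.1 ((sq_abs C).symm ▸ h1.2)).trans ?_
          refine mul_le_mul_of_nonneg_right ?_ (by positivity)
          refine Real.le_sqrt_of_sq_le ?_
          rw [← real_inner_self_eq_norm_sq, ← integral_mul_eq_inner]
          have h2 := hC' n k k.2
          simp only [sq] at h2
          exact h2.trans (le_abs_self _)
      _ = _ := by
          simp only [Finset.sum_const, Finset.card_univ, Fintype.card_coe, nsmul_eq_mul, s]
          ring
  set R := √|C'| * |C| * ((D.s n : ℝ) * ((D.q n : ℝ) ^ 2)⁻¹) with hR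
  have hR0 : 0 ≤ R := by positivity
  refine le_of_sq_le_sq ?_ (by positivity)
  rw [l2norm_sq, mul_pow, Real.sq_sqrt (by positivity), dotProduct]
  calc _ ≤ ∑ _i : Fin n, R ^ 2 := Finset.sum_le_sum fun i _ => by
        rw [← sq, ← sq_abs]; exact pow_le_pow_left₀ (abs_nonneg _) (hcoord i) 2
    _ = _ := by simp

variable {n}

theorem Theta_col_sq (hn : 0 < n) {j : Fin (D.p n)} {l : Fin (D.q n)} (h : D.scale n j l ≠ 0) :
    ∑ i, D.Theta n j i l ^ 2 = n := by
  have hn' : (0 : ℝ) < n := by exact_mod_cast hn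
  have h1 : D.scale n j l ^ 2 = (∑ i, D.theta n i j l ^ 2) / n := by
    rw [scale, div_pow, l2norm_sq, Real.sq_sqrt hn'.le]
    simp [dotProduct, sq]
  simp only [Theta, of_apply, div_pow]
  rw [← Finset.sum_div, div_eq_iff (pow_ne_zero 2 h), h1]
  field_simp

theorem a_le (j : D.M0 n) : D.a n ≤ l2norm (D.Theta n j *ᵥ D.eta0 n j) / √n :=
  ciInf_le (Set.finite_range _).bddBelow j

variable (D n)

/-- The normalized block `n^{-1/2} Θ_k`, as a map on the stacked signal coefficients. -/
noncomputable def block (k : D.M0 n) :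
    EuclideanSpace ℝ (D.M0 n × Fin (D.q n)) →L[ℝ] EuclideanSpace ℝ (Fin n) :=
  LinearMap.toContinuousLinearMap
    { toFun := fun u => WithLp.toLp 2 ((√n)⁻¹ • (D.Theta n k *ᵥ fun l => u (k, l)))
      map_add' := fun u v => by
        have e : (fun l => (u + v) (k, l)) = (fun l => u (k, l)) + fun l => v (k, l) := rfl
        rw [e, mulVec_add, smul_add, WithLp.toLp_add]
      map_smul' := fun c u => by
        have e : (fun l => (c • u) (k, l)) = c • fun l => u (k, l) := rfl
        rw [e, mulVec_smul, smul_comm, WithLp.toLp_smul, RingHom.id_apply] }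

theorem block_apply (k : D.M0 n) (u : EuclideanSpace ℝ (D.M0 n × Fin (D.q n))) :
    D.block n k u = WithLp.toLp 2 ((√n)⁻¹ • (D.Theta n k *ᵥ fun l => u (k, l))) := rfl

theorem norm_block (k : D.M0 n) (u : EuclideanSpace ℝ (D.M0 n × Fin (D.q n))) :
    ‖D.block n k u‖ = 1 / √n * l2norm (D.Theta n k *ᵥ fun l => u (k, l)) := by
  rw [block_apply, WithLp.toLp_smul, norm_smul, norm_inv, Real.norm_of_nonneg (Real.sqrt_nonneg _),
    one_div]
  rfl

theorem sum_block (u : EuclideanSpace ℝ (D.M0 n × Fin (D.q n))) :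
    ∑ k, D.block n k u = WithLp.toLp 2 ((√n)⁻¹ • (D.ThetaM0 n *ᵥ u.ofLp)) := by
  simp only [block_apply, ThetaM0_mulVec, Finset.smul_sum, WithLp.toLp_sum]

theorem inner_toLp_inv_sqrt_smul (v w : Fin n → ℝ) :
    inner ℝ (WithLp.toLp 2 ((√n)⁻¹ • v)) (WithLp.toLp 2 ((√n)⁻¹ • w)) = (n : ℝ)⁻¹ * (v ⬝ᵥ w) := by
  rw [EuclideanSpace.inner_toLp_toLp]
  simp only [star_trivial, smul_dotProduct, dotProduct_smul, smul_eq_mul]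
  rw [← mul_assoc, ← mul_inv, Real.mul_self_sqrt (by positivity), dotProduct_comm]

/-- The stacked gradient of the penalty at `u`, of which `v0` is the value at the truth. -/
noncomputable def penGradient (u : D.M0 n × Fin (D.q n) → ℝ) : D.M0 n × Fin (D.q n) → ℝ := fun k =>
  deriv (D.pen n) (1 / √n * l2norm (D.Theta n k.1 *ᵥ fun l => u (k.1, l))) * (1 / √n)
    * (((D.Theta n k.1)ᵀ *ᵥ (D.Theta n k.1 *ᵥ fun l => u (k.1, l))) k.2
      / l2norm (D.Theta n k.1 *ᵥ fun l => u (k.1, l)))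

theorem penGradient_trueCoef : D.penGradient n (D.trueCoef n) = D.v0 n := rfl

theorem dotProduct_penGradient (u h : EuclideanSpace ℝ (D.M0 n × Fin (D.q n))) :
    h.ofLp ⬝ᵥ D.penGradient n u.ofLp = ∑ k, deriv (D.pen n) ‖D.block n k u‖
      * (inner ℝ (D.block n k u) (D.block n k h) / ‖D.block n k u‖) := by
  rw [dotProduct, Fintype.sum_prod_type]
  refine Finset.sum_congr rfl fun k _ => ?_
  rw [norm_block, block_apply, block_apply, inner_toLp_inv_sqrt_smul, dotProduct_comm,
    mulVec_dotProduct (D.Theta n k) (fun l => h (k, l))]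
  simp only [penGradient, dotProduct, Finset.sum_div, Finset.mul_sum]
  refine Finset.sum_congr rfl fun l _ => ?_
  have h1 : (n : ℝ)⁻¹ = (1 / √n) * (1 / √n) := by
    rw [← one_div, div_mul_div_comm, one_mul, Real.mul_self_sqrt (by positivity)]
  rw [h1]
  rcases eq_or_ne (1 / √(n : ℝ)) 0 with h0 | h0
  · rw [h0]; simp
  · rw [mul_assoc (1 / √(n : ℝ)) (1 / √(n : ℝ)), mul_div_mul_left _ _ h0]
    ring

end LinearFAR

/-! ### The solution on the event of good errors -/

namespace LinearFAR

variable (D : LinearFAR) (n : ℕ)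

/-- The orthogonal projection onto the column space of the block `Θ_j`. -/
noncomputable def noiseProj (j : Fin (D.p n)) : Matrix (Fin n) (Fin n) ℝ :=
  D.Theta n j * ((D.Theta n j)ᵀ * D.Theta n j)⁻¹ * (D.Theta n j)ᵀ

/-- The orthogonal projection onto the column space of the signal design `Θ_{M₀}`. -/
noncomputable def signalProj : Matrix (Fin n) (Fin n) ℝ :=
  D.ThetaM0 n * (D.gramM0 n)⁻¹ * (D.ThetaM0 n)ᵀ

/-- The errors for which the estimator is well behaved: their correlation with the signal columns
is less than `n g`, and their residual has squared length less than `τ` in the column space of each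
noise block. -/
def goodErrors (g τ : ℝ) : Set (Fin n → ℝ) :=
  {e | l2norm ((D.ThetaM0 n)ᵀ *ᵥ e) < n * g} ∩
    ⋂ j : {j // j ∉ D.M0 n},
      {e | l2norm ((D.noiseProj n j * (1 - D.signalProj n)) *ᵥ e) ^ 2 < τ}

theorem isOpen_goodErrors (g τ : ℝ) : IsOpen (D.goodErrors n g τ) := by
  refine IsOpen.inter ?_ (isOpen_iInter_of_finite fun j => ?_)
  · exact isOpen_lt (continuous_l2norm.comp (by fun_prop)) continuous_const
  · exact isOpen_lt ((continuous_l2norm.comp (by fun_prop)).pow 2) continuous_const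

/-- The regularity of the sample of size `n` that the asymptotic conditions provide for large `n`.
The eigenvalues of the signal Gram matrix over `n` lie in `[c₀, c₀⁻¹]`, `K` bounds the curvature of
the penalty, `δ` is the radius of the ball around the truth that contains the estimator, `R` bounds
the truncation error, and `g`, `τ` are the noise levels of `goodErrors`. -/
structure RegularSample (c₀ K δ R g τ : ℝ) : Prop where
  n_pos : 0 < n
  nonempty : Nonempty (D.M0 n × Fin (D.q n))
  shape : PenaltyShape (D.pen n) (D.a n / 2) K
  c_pos : 0 < c₀
  curv_lt : 4 * K < c₀ ^ 2
  eig : ∀ x, c₀ * n * (x ⬝ᵥ x) ≤ l2norm (D.ThetaM0 n *ᵥ x) ^ 2 ∧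
    l2norm (D.ThetaM0 n *ᵥ x) ^ 2 ≤ n / c₀ * (x ⬝ᵥ x)
  scale_ne : ∀ (j : Fin (D.p n)) (l : Fin (D.q n)), D.scale n j l ≠ 0
  noise_inv : ∀ j ∉ D.M0 n, IsUnit ((D.Theta n j)ᵀ * D.Theta n j)
  incoherent : ∀ j ∉ D.M0 n,
    norm_inf_two (D.noiseProj n j * D.ThetaM0 n * (D.gramM0 n)⁻¹)
      < ENNReal.ofReal (√c₀ / (2 * √n))
        * (slopeAtZero (D.pen n) / ENNReal.ofReal (deriv (D.pen n) (D.a n / 2)))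
  radius_pos : 0 < δ
  radius_lt : δ < √c₀ * (D.a n / 2)
  approx_nonneg : 0 ≤ R
  approx : l2norm (D.approxError n) ≤ √n * R
  grad : g + R / √c₀ + √(D.s n) / √c₀ * deriv (D.pen n) (D.a n / 2) < c₀ * δ / 2
  noise : ENNReal.ofReal (√τ / √n + R) < slopeAtZero (D.pen n) / 2

/-- The true signal coefficients, as a point of Euclidean space. -/
noncomputable def center : EuclideanSpace ℝ (D.M0 n × Fin (D.q n)) := WithLp.toLp 2 (D.trueCoef n)

/-- The normalized responses `n^{-1/2} Y`. -/
noncomputable def normResponse (e : Fin n → ℝ) : EuclideanSpace ℝ (Fin n) :=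
  WithLp.toLp 2 ((√n)⁻¹ • D.response n e)

/-- First-order condition for the signal coefficients. -/
def IsSolution (δ : ℝ) (e : Fin n → ℝ) (u : EuclideanSpace ℝ (D.M0 n × Fin (D.q n))) : Prop :=
  ‖u - D.center n‖ ≤ δ ∧ IsBlockStationary (D.block n) (D.pen n) (D.normResponse n e) u

variable {D n} {c₀ K δ R g τ : ℝ}

theorem norm_toLp_sq {ι : Type*} [Fintype ι] (x : ι → ℝ) : ‖WithLp.toLp 2 x‖ ^ 2 = x ⬝ᵥ x :=
  l2norm_sq x

theorem normResponse_eq (e : Fin n → ℝ) : D.normResponse n e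
    = ∑ k, D.block n k (D.center n) + WithLp.toLp 2 ((√n)⁻¹ • (D.approxError n + e)) := by
  rw [normResponse, response_eq, sum_block, smul_add, WithLp.toLp_add]
  rfl

theorem norm_sum_block_sq (u : EuclideanSpace ℝ (D.M0 n × Fin (D.q n))) :
    ‖∑ k, D.block n k u‖ ^ 2 = (n : ℝ)⁻¹ * l2norm (D.ThetaM0 n *ᵥ u.ofLp) ^ 2 := by
  rw [sum_block, ← real_inner_self_eq_norm_sq, inner_toLp_inv_sqrt_smul, l2norm_sq]

theorem two_mul_le_norm_block_center (k : D.M0 n) :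
    2 * (D.a n / 2) ≤ ‖D.block n k (D.center n)‖ := by
  rw [norm_block, one_div, inv_mul_eq_div]
  have := a_le k
  simp only [center, trueCoef]
  linarith

namespace RegularSample

variable (H : D.RegularSample n c₀ K δ R g τ)
include H

theorem n_pos' : (0 : ℝ) < n := by exact_mod_cast H.n_pos

theorem blockDesign : BlockDesign (D.block n) c₀ := by
  have hn := H.n_pos'
  have hc := H.c_pos
  have hu : ∀ u : EuclideanSpace ℝ (D.M0 n × Fin (D.q n)), u.ofLp ⬝ᵥ u.ofLp = ‖u‖ ^ 2 :=
    fun u => (norm_toLp_sq u.ofLp).symm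
  have hupper : ∀ u, ‖∑ k, D.block n k u‖ ^ 2 ≤ c₀⁻¹ * ‖u‖ ^ 2 := fun u => by
    rw [norm_sum_block_sq, ← hu]
    have := (H.eig u.ofLp).2
    calc _ ≤ (n : ℝ)⁻¹ * (n / c₀ * (u.ofLp ⬝ᵥ u.ofLp)) := by gcongr
      _ = _ := by field_simp
  refine ⟨hc, fun u => ?_, fun u => ?_⟩
  · rw [norm_sum_block_sq, ← hu]
    have := (H.eig u.ofLp).1
    calc c₀ * (u.ofLp ⬝ᵥ u.ofLp) = (n : ℝ)⁻¹ * (c₀ * n * (u.ofLp ⬝ᵥ u.ofLp)) := by field_simp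
      _ ≤ _ := by gcongr
  · classical
    -- the bound for the whole design, applied to one block at a time
    have hk : ∀ k, ‖D.block n k u‖ ^ 2 ≤ c₀⁻¹ * ∑ l, u (k, l) ^ 2 := fun k => by
      set v : EuclideanSpace ℝ (D.M0 n × Fin (D.q n)) :=
        WithLp.toLp 2 fun m => if m.1 = k then u m else 0 with hv
      have h1 : ∑ m, D.block n m v = D.block n k u := by
        rw [Finset.sum_eq_single k]
        · rw [block_apply, block_apply]; simp [hv]
        · intro m _ hm
          rw [block_apply]
          have : (fun l => v (m, l)) = 0 := by ext l; simp [hv, hm]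
          rw [this, mulVec_zero, smul_zero, WithLp.toLp_zero]
        · simp
      have h2 := hupper v
      rw [h1, ← hu] at h2
      refine h2.trans_eq ?_
      congr 1
      rw [dotProduct, Fintype.sum_prod_type, Finset.sum_eq_single k]
      · simp [hv, sq]
      · intro m _ hm; simp [hv, hm]
      · simp
    calc _ ≤ ∑ k, c₀⁻¹ * ∑ l, u (k, l) ^ 2 := Finset.sum_le_sum fun k _ => hk k
      _ = _ := by rw [← Finset.mul_sum, ← Fintype.sum_prod_type', EuclideanSpace.real_norm_sq_eq]

theorem c_le_one : c₀ ≤ 1 := by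
  classical
  obtain ⟨k⟩ := H.nonempty
  have h := H.eig (Pi.single k 1)
  have hn := H.n_pos'
  have hc := H.c_pos
  have h1 : (Pi.single k 1 : D.M0 n × Fin (D.q n) → ℝ) ⬝ᵥ Pi.single k 1 = 1 := by simp
  rw [h1] at h
  have h2 : c₀ * n ≤ n / c₀ := by linarith [h.1, h.2]
  rw [le_div_iff₀ hc] at h2
  have h3 : c₀ * c₀ ≤ 1 := le_of_mul_le_mul_right (by linarith) hn
  nlinarith

theorem isUnit_gramM0 : IsUnit ((D.ThetaM0 n)ᵀ * D.ThetaM0 n) := by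
  have hpos : ((D.ThetaM0 n)ᵀ * D.ThetaM0 n).PosDef := by
    refine Matrix.PosDef.of_dotProduct_mulVec_pos (posSemidef_transpose_mul_self _).isHermitian
      fun x hx => ?_
    rw [star_trivial, ← mulVec_dotProduct_mulVec, ← l2norm_sq]
    have h1 := (H.eig x).1
    have h2 : 0 < x ⬝ᵥ x := by
      rw [← l2norm_sq]
      have : l2norm x ≠ 0 := fun h => hx (l2norm_eq_zero.1 h)
      positivity
    have hn := H.n_pos'
    have hc := H.c_pos
    have : 0 < c₀ * n * (x ⬝ᵥ x) := by positivity
    linarith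
  exact hpos.isUnit

theorem l2norm_ThetaM0_mulVec_le (x : D.M0 n × Fin (D.q n) → ℝ) :
    l2norm (D.ThetaM0 n *ᵥ x) ≤ √n / √c₀ * l2norm x := by
  have hn := H.n_pos'
  have hc := H.c_pos
  refine le_of_sq_le_sq ?_ (mul_nonneg (by positivity) (l2norm_nonneg _))
  rw [mul_pow, div_pow, Real.sq_sqrt hn.le, Real.sq_sqrt hc.le, l2norm_sq x]
  exact (H.eig x).2

theorem exists_isSolution {e : Fin n → ℝ} (he : e ∈ D.goodErrors n g τ) :
    ∃ u, D.IsSolution n δ e u := by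
  have hn := H.n_pos'
  have hc := H.c_pos
  have he1 : l2norm ((D.ThetaM0 n)ᵀ *ᵥ e) < n * g := he.1
  simp only [IsSolution, normResponse_eq]
  refine H.blockDesign.exists_isBlockStationary H.shape two_mul_le_norm_block_center
    H.radius_pos H.radius_lt.le
    (g := g + R / √c₀) (fun h => ?_) ?_
  · rw [sum_block, inner_toLp_inv_sqrt_smul, add_dotProduct]
    have h1 : e ⬝ᵥ (D.ThetaM0 n *ᵥ h.ofLp) ≤ n * g * ‖h‖ := by
      rw [dotProduct_comm, mulVec_dotProduct, dotProduct_comm]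
      exact (dotProduct_le_l2norm _ _).trans
        (mul_le_mul_of_nonneg_right he1.le (norm_nonneg h))
    have h2 : D.approxError n ⬝ᵥ (D.ThetaM0 n *ᵥ h.ofLp) ≤ n * (R / √c₀) * ‖h‖ := by
      refine (dotProduct_le_l2norm _ _).trans ?_
      calc _ ≤ (√n * R) * (√n / √c₀ * ‖h‖) :=
            mul_le_mul H.approx (H.l2norm_ThetaM0_mulVec_le h.ofLp) (l2norm_nonneg _)
              (mul_nonneg (Real.sqrt_nonneg _) H.approx_nonneg)
        _ = (√n * √n) * (R / √c₀) * ‖h‖ := by ring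
        _ = _ := by rw [Real.mul_self_sqrt hn.le]
    calc _ ≤ (n : ℝ)⁻¹ * (n * (R / √c₀) * ‖h‖ + n * g * ‖h‖) := by gcongr
      _ = _ := by field_simp; ring
  · have := H.grad
    rwa [Fintype.card_coe]

theorem norm_sub_le {e₁ e₂ : Fin n → ℝ} {u₁ u₂ : EuclideanSpace ℝ (D.M0 n × Fin (D.q n))}
    (h₁ : D.IsSolution n δ e₁ u₁) (h₂ : D.IsSolution n δ e₂ u₂) :
    c₀ / 2 * ‖u₁ - u₂‖ ≤ (√n)⁻¹ / √c₀ * l2norm (e₁ - e₂) := by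
  have hn := H.n_pos'
  have hc := H.c_pos
  refine H.blockDesign.norm_sub_le_of_isBlockStationary H.shape H.curv_lt.le
    two_mul_le_norm_block_center H.radius_lt.le h₁.1 h₂.1 h₁.2 h₂.2
    (mul_nonneg (by positivity) (l2norm_nonneg _)) fun h => ?_
  have h1 : D.normResponse n e₁ - D.normResponse n e₂ = WithLp.toLp 2 ((√n)⁻¹ • (e₁ - e₂)) := by
    rw [normResponse_eq, normResponse_eq, add_sub_add_left_eq_sub, ← WithLp.toLp_sub, ← smul_sub,
      add_sub_add_left_eq_sub]
  rw [h1, sum_block, inner_toLp_inv_sqrt_smul]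
  have h2 := (dotProduct_le_l2norm (e₁ - e₂) (D.ThetaM0 n *ᵥ h.ofLp)).trans
    (mul_le_mul_of_nonneg_left (H.l2norm_ThetaM0_mulVec_le h.ofLp) (l2norm_nonneg _))
  calc _ ≤ (n : ℝ)⁻¹ * (l2norm (e₁ - e₂) * (√n / √c₀ * l2norm h.ofLp)) := by gcongr
    _ = ((n : ℝ)⁻¹ * √n) / √c₀ * l2norm (e₁ - e₂) * l2norm h.ofLp := by ring
    _ = (√n)⁻¹ / √c₀ * l2norm (e₁ - e₂) * l2norm h.ofLp := by
      congr 3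
      rw [← Real.sqrt_inv]
      have : (n : ℝ)⁻¹ = √((n : ℝ)⁻¹) * √((n : ℝ)⁻¹) := (Real.mul_self_sqrt (by positivity)).symm
      nth_rw 1 [this]
      rw [mul_assoc, ← Real.sqrt_mul (by positivity), inv_mul_cancel₀ hn.ne', Real.sqrt_one,
        mul_one]
    _ = _ := rfl

/-- The solution is a measurable function of the errors, because it is continuous on the open set
of good errors. -/
theorem exists_measurable_solution :
    ∃ u : (Fin n → ℝ) → EuclideanSpace ℝ (D.M0 n × Fin (D.q n)), Measurable u ∧
      ∀ e ∈ D.goodErrors n g τ, D.IsSolution n δ e (u e) := by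
  classical
  have hc := H.c_pos
  choose! f hf using fun e (he : e ∈ D.goodErrors n g τ) => H.exists_isSolution he
  have hcont : ContinuousOn f (D.goodErrors n g τ) := by
    intro e he
    rw [ContinuousWithinAt, tendsto_iff_norm_sub_tendsto_zero]
    have hlim : Tendsto (fun e' => 2 / c₀ * ((√n)⁻¹ / √c₀ * l2norm (e' - e)))
        (𝓝[D.goodErrors n g τ] e) (𝓝 0) := by
      have : Continuous fun e' : Fin n → ℝ => 2 / c₀ * ((√n)⁻¹ / √c₀ * l2norm (e' - e)) :=
        continuous_const.mul (continuous_const.mul (continuous_l2norm.comp (by fun_prop)))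
      have h0 := this.tendsto e
      rw [sub_self, l2norm_eq_zero.2 rfl, mul_zero, mul_zero] at h0
      exact h0.mono_left nhdsWithin_le_nhds
    refine squeeze_zero' (Eventually.of_forall fun _ => norm_nonneg _) ?_ hlim
    filter_upwards [self_mem_nhdsWithin] with e' he'
    have := H.norm_sub_le (hf e' he') (hf e he)
    calc _ = 2 / c₀ * (c₀ / 2 * ‖f e' - f e‖) := by field_simp
      _ ≤ _ := by gcongr
  refine ⟨(D.goodErrors n g τ).piecewise f fun _ => 0, ?_, fun e he => ?_⟩
  · exact hcont.measurable_piecewise continuousOn_const (D.isOpen_goodErrors n g τ).measurableSet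
  · rw [Set.piecewise_eq_of_mem _ _ _ he]; exact hf e he

end RegularSample

end LinearFAR

/-! ### Noise predictors, local minimality and the pivot -/

namespace LinearFAR

variable {D : LinearFAR} {n : ℕ} {c₀ K δ R g τ : ℝ}

namespace RegularSample

variable (H : D.RegularSample n c₀ K δ R g τ) {e : Fin n → ℝ}
  {u : EuclideanSpace ℝ (D.M0 n × Fin (D.q n))} (hu : D.IsSolution n δ e u)
include H hu

/-- The first-order condition in matrix form. -/
theorem score_eq : (D.ThetaM0 n)ᵀ *ᵥ (D.response n e - D.ThetaM0 n *ᵥ u.ofLp)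
    = (n : ℝ) • D.penGradient n u.ofLp := by
  have hn := H.n_pos'
  refine dotProduct_eq _ _ fun h => ?_
  have h1 := hu.2 (WithLp.toLp 2 h)
  rw [← dotProduct_penGradient, sum_block, sum_block, normResponse, ← WithLp.toLp_sub, ← smul_sub,
    inner_toLp_inv_sqrt_smul] at h1
  rw [dotProduct_comm, ← mulVec_dotProduct, dotProduct_comm, smul_dotProduct, smul_eq_mul,
    dotProduct_comm _ h, ← h1, ← mul_assoc, mul_inv_cancel₀ hn.ne', one_mul]

theorem gramM0_mulVec_sub : D.gramM0 n *ᵥ (u.ofLp - D.trueCoef n)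
    = (D.ThetaM0 n)ᵀ *ᵥ (D.approxError n + e) - (n : ℝ) • D.penGradient n u.ofLp := by
  rw [← H.score_eq hu, response_eq, ← mulVec_sub, gramM0, ← mulVec_mulVec]
  congr 1
  rw [mulVec_sub]
  abel

/-- The residual consists of the part of the errors and of the truncation error that the signal
predictors do not explain, and of the shrinkage caused by the penalty. -/
theorem residual_eq : D.response n e - D.ThetaM0 n *ᵥ u.ofLp
    = (1 - D.signalProj n) *ᵥ (D.approxError n + e)
      + (n : ℝ) • ((D.ThetaM0 n * (D.gramM0 n)⁻¹) *ᵥ D.penGradient n u.ofLp) := by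
  have hG : IsUnit (D.gramM0 n).det := (isUnit_iff_isUnit_det _).1 H.isUnit_gramM0
  have h1 : u.ofLp - D.trueCoef n = (D.gramM0 n)⁻¹ *ᵥ
      ((D.ThetaM0 n)ᵀ *ᵥ (D.approxError n + e) - (n : ℝ) • D.penGradient n u.ofLp) := by
    rw [← H.gramM0_mulVec_sub hu, mulVec_mulVec, nonsing_inv_mul _ hG, one_mulVec]
  have h2 : D.response n e - D.ThetaM0 n *ᵥ u.ofLp
      = (D.approxError n + e) - D.ThetaM0 n *ᵥ (u.ofLp - D.trueCoef n) := by
    rw [response_eq, mulVec_sub]; abel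
  rw [h2, h1, signalProj, sub_mulVec, one_mulVec, mulVec_sub, mulVec_sub, mulVec_smul, mulVec_smul,
    mulVec_mulVec, mulVec_mulVec, mulVec_mulVec]
  abel

theorem le_norm_block (k : D.M0 n) : D.a n / 2 ≤ ‖D.block n k u‖ :=
  H.blockDesign.le_norm_apply two_mul_le_norm_block_center H.radius_lt.le hu.1 k

/-- The entries of the penalty gradient are bounded by its slope at `a_n / 2`, because the columns
of the design have norm `√n`. -/
theorem norm_penGradient_le : ‖D.penGradient n u.ofLp‖ ≤ deriv (D.pen n) (D.a n / 2) := by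
  have hn := H.n_pos'
  have hsn : 0 < √(n : ℝ) := Real.sqrt_pos.2 hn
  rw [pi_norm_le_iff_of_nonneg (H.shape.deriv_nonneg _ H.shape.pos)]
  intro k
  have h1 := H.le_norm_block hu k.1
  rw [norm_block] at h1
  set x := D.Theta n k.1 *ᵥ fun l => u.ofLp (k.1, l) with hx
  have hpos : 0 < l2norm x := by
    have := H.shape.pos
    by_contra hneg
    have h2 : l2norm x = 0 := le_antisymm (not_lt.1 hneg) (l2norm_nonneg _)
    rw [h2, mul_zero] at h1
    linarith
  have h2 : |((D.Theta n k.1)ᵀ *ᵥ x) k.2| ≤ √n * l2norm x := by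
    refine (abs_dotProduct_le_l2norm _ _).trans_eq ?_
    congr 1
    rw [eq_comm, Real.sqrt_eq_iff_mul_self_eq hn.le (l2norm_nonneg _), ← sq, l2norm_sq,
      ← Theta_col_sq H.n_pos (H.scale_ne k.1 k.2)]
    simp [dotProduct, sq]
  have h3 := H.shape.deriv_le h1
  have h4 := H.shape.deriv_nonneg _ (lt_of_lt_of_le H.shape.pos h1)
  rw [penGradient, Real.norm_eq_abs, abs_mul, abs_mul, abs_of_pos (one_div_pos.2 hsn),
    abs_div (((D.Theta n k.1)ᵀ *ᵥ _) k.2), ← hx, abs_of_pos hpos, abs_of_nonneg h4]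
  calc _ ≤ deriv (D.pen n) (1 / √n * l2norm x) * (1 / √n) * (√n * l2norm x / l2norm x) := by gcongr
    _ = deriv (D.pen n) (1 / √n * l2norm x) := by field_simp
    _ ≤ _ := h3

end RegularSample

theorem noiseProj_mul_Theta {j : Fin (D.p n)} (hj : IsUnit ((D.Theta n j)ᵀ * D.Theta n j)) :
    D.noiseProj n j * D.Theta n j = D.Theta n j := by
  rw [noiseProj, Matrix.mul_assoc, Matrix.mul_assoc, nonsing_inv_mul _
    ((isUnit_iff_isUnit_det _).1 hj), Matrix.mul_one]

theorem noiseProj_transpose (j : Fin (D.p n)) : (D.noiseProj n j)ᵀ = D.noiseProj n j := by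
  rw [noiseProj, transpose_mul, transpose_mul, transpose_nonsing_inv, transpose_transpose,
    transpose_mul, transpose_transpose, Matrix.mul_assoc]

theorem l2norm_noiseProj_mulVec_le {j : Fin (D.p n)} (hj : IsUnit ((D.Theta n j)ᵀ * D.Theta n j))
    (x : Fin n → ℝ) : l2norm (D.noiseProj n j *ᵥ x) ≤ l2norm x := by
  have hV := whitened_transpose_mul_self hj
  rw [noiseProj, ← whitened_mul_transpose, ← mulVec_mulVec, l2norm_isometry_mulVec hV]
  exact l2norm_transpose_mulVec_le hV x

namespace RegularSample

variable (H : D.RegularSample n c₀ K δ R g τ)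
include H

theorem l2norm_one_sub_signalProj_mulVec_le (x : Fin n → ℝ) :
    l2norm ((1 - D.signalProj n) *ᵥ x) ≤ l2norm x := by
  rw [signalProj, gramM0, ← whitened_mul_transpose]
  exact l2norm_sub_proj_le (whitened_transpose_mul_self H.isUnit_gramM0) x

/-- The residual is correlated with every noise predictor less than the slope of the penalty at
zero. Incoherence accounts for half of the slope, the noise level for the other half. -/
theorem ofReal_l2norm_noiseProj_lt {e : Fin n → ℝ} (he : e ∈ D.goodErrors n g τ)
    {u : EuclideanSpace ℝ (D.M0 n × Fin (D.q n))} (hu : D.IsSolution n δ e u)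
    {j : Fin (D.p n)} (hj : j ∉ D.M0 n) :
    ENNReal.ofReal (l2norm (D.noiseProj n j *ᵥ (D.response n e - D.ThetaM0 n *ᵥ u.ofLp)) / √n)
      < slopeAtZero (D.pen n) := by
  have hn := H.n_pos'
  have hsn : 0 < √(n : ℝ) := Real.sqrt_pos.2 hn
  rcases eq_or_ne (slopeAtZero (D.pen n)) ⊤ with htop | htop
  · rw [htop]; exact ENNReal.ofReal_lt_top
  set B := D.noiseProj n j * D.ThetaM0 n * (D.gramM0 n)⁻¹ with hB
  set v := D.penGradient n u.ofLp with hv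
  set d := deriv (D.pen n) (D.a n / 2) with hd
  have hd0 : 0 ≤ d := H.shape.deriv_nonneg _ H.shape.pos
  have e1 : D.noiseProj n j *ᵥ (D.response n e - D.ThetaM0 n *ᵥ u.ofLp)
      = (D.noiseProj n j *ᵥ ((1 - D.signalProj n) *ᵥ D.approxError n)
        + (D.noiseProj n j * (1 - D.signalProj n)) *ᵥ e) + (n : ℝ) • (B *ᵥ v) := by
    rw [H.residual_eq hu, mulVec_add, mulVec_add, mulVec_add, mulVec_smul, mulVec_mulVec e,
      mulVec_mulVec (D.penGradient n u.ofLp), hB, Matrix.mul_assoc (D.noiseProj n j) (D.ThetaM0 n)]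
  have h1 : l2norm (D.noiseProj n j *ᵥ ((1 - D.signalProj n) *ᵥ D.approxError n)) ≤ √n * R :=
    ((l2norm_noiseProj_mulVec_le (H.noise_inv j hj) _).trans
      (H.l2norm_one_sub_signalProj_mulVec_le _)).trans H.approx
  have h2 : l2norm ((D.noiseProj n j * (1 - D.signalProj n)) *ᵥ e) ≤ √τ :=
    Real.le_sqrt_of_sq_le (Set.mem_iInter.1 he.2 ⟨j, hj⟩ : _ < _).le
  have h3 : ENNReal.ofReal (√n * l2norm (B *ᵥ v)) ≤ slopeAtZero (D.pen n) / 2 := by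
    rcases hd0.eq_or_lt with hd0 | hd0
    · have : v = 0 := by
        rw [← norm_le_zero_iff]; exact (H.norm_penGradient_le hu).trans hd0.symm.le
      rw [this, mulVec_zero, l2norm_eq_zero.2 rfl]; simp
    · have h4 := ofReal_l2norm_mulVec_le B (H.norm_penGradient_le hu)
      have h5 := (H.incoherent j hj).le
      have hdE : ENNReal.ofReal d ≠ 0 := by simpa using hd0
      rw [ENNReal.ofReal_mul hsn.le]
      calc _ ≤ ENNReal.ofReal √n * (ENNReal.ofReal d * (ENNReal.ofReal (√c₀ / (2 * √n))
              * (slopeAtZero (D.pen n) / ENNReal.ofReal d))) := by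
            gcongr; exact h4.trans (by gcongr)
        _ = (ENNReal.ofReal √n * ENNReal.ofReal (√c₀ / (2 * √n)))
              * (ENNReal.ofReal d * (slopeAtZero (D.pen n) / ENNReal.ofReal d)) := by ring
        _ = ENNReal.ofReal (√c₀ / 2) * slopeAtZero (D.pen n) := by
            rw [ENNReal.mul_div_cancel hdE ENNReal.ofReal_ne_top, ← ENNReal.ofReal_mul hsn.le]
            congr 2; field_simp
        _ ≤ ENNReal.ofReal (1 / 2) * slopeAtZero (D.pen n) := by
            gcongr
            exact Real.sqrt_le_one.2 H.c_le_one
        _ = _ := by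
            rw [ENNReal.ofReal_div_of_pos (by norm_num), ENNReal.div_eq_inv_mul,
              ENNReal.div_eq_inv_mul]
            simp
  have h6 : l2norm (D.noiseProj n j *ᵥ (D.response n e - D.ThetaM0 n *ᵥ u.ofLp)) / √n
      ≤ (√τ / √n + R) + √n * l2norm (B *ᵥ v) := by
    rw [div_le_iff₀ hsn, e1]
    refine (l2norm_add_le _ _).trans ?_
    rw [l2norm_smul, abs_of_pos hn]
    have h7 := l2norm_add_le (D.noiseProj n j *ᵥ ((1 - D.signalProj n) *ᵥ D.approxError n))
      ((D.noiseProj n j * (1 - D.signalProj n)) *ᵥ e)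
    have h8 : (√τ / √n + R + √n * l2norm (B *ᵥ v)) * √n
        = √τ + √n * R + (√n * √n) * l2norm (B *ᵥ v) := by field_simp
    rw [h8, Real.mul_self_sqrt hn.le]
    linarith
  have hR : 0 ≤ √τ / √n + R := add_nonneg (by positivity) H.approx_nonneg
  calc _ ≤ ENNReal.ofReal (√τ / √n + R) + ENNReal.ofReal (√n * l2norm (B *ᵥ v)) := by
        rw [← ENNReal.ofReal_add hR (mul_nonneg hsn.le (l2norm_nonneg _))]
        exact ENNReal.ofReal_le_ofReal h6
    _ < slopeAtZero (D.pen n) / 2 + slopeAtZero (D.pen n) / 2 :=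
        ENNReal.add_lt_add_of_lt_of_le (ne_top_of_le_ne_top (ENNReal.div_ne_top htop (by simp)) h3)
          H.noise h3
    _ = _ := ENNReal.add_halves _

theorem lt_norm_block {e : Fin n → ℝ} {u : EuclideanSpace ℝ (D.M0 n × Fin (D.q n))}
    (hu : D.IsSolution n δ e u) (k : D.M0 n) : D.a n / 2 < ‖D.block n k u‖ := by
  have h1 := H.blockDesign.norm_apply_le (u - D.center n) k
  have h2 : 0 < √c₀ := Real.sqrt_pos.2 H.c_pos
  have h3 : ‖u - D.center n‖ / √c₀ < D.a n / 2 := by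
    rw [div_lt_iff₀ h2]; linarith [hu.1, H.radius_lt]
  have h4 : ‖D.block n k (D.center n)‖ ≤ ‖D.block n k u‖ + ‖D.block n k (u - D.center n)‖ := by
    rw [map_sub, norm_sub_rev]
    exact norm_le_insert' _ _
  linarith [two_mul_le_norm_block_center (D := D) k]

end RegularSample

/-- The coefficients `u` of the signal predictors, extended to all predictors by zero. -/
noncomputable def fullCoef (u : EuclideanSpace ℝ (D.M0 n × Fin (D.q n))) :
    Fin (D.p n) → Fin (D.q n) → ℝ :=
  fun j l => if h : j ∈ D.M0 n then u (⟨j, h⟩, l) else 0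

theorem fullCoef_of_mem (u : EuclideanSpace ℝ (D.M0 n × Fin (D.q n))) (k : D.M0 n)
    (l : Fin (D.q n)) : fullCoef u k l = u (k, l) := by
  simp [fullCoef]

theorem fullCoef_of_notMem (u : EuclideanSpace ℝ (D.M0 n × Fin (D.q n))) {j : Fin (D.p n)}
    (hj : j ∉ D.M0 n) : fullCoef u j = 0 := by
  ext l; simp [fullCoef, hj]

theorem continuous_fullCoef :
    Continuous (fullCoef : EuclideanSpace ℝ (D.M0 n × Fin (D.q n)) → _) := by
  refine continuous_pi fun j => continuous_pi fun l => ?_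
  unfold fullCoef
  split_ifs <;> fun_prop

/-- The signal coefficients among those of all predictors. -/
noncomputable def signalCoef (η : Fin (D.p n) → Fin (D.q n) → ℝ) :
    EuclideanSpace ℝ (D.M0 n × Fin (D.q n)) :=
  WithLp.toLp 2 fun k => η k.1 k.2

/-- The normalized contribution of one predictor to the fit. -/
noncomputable def fitOf (η : Fin (D.p n) → Fin (D.q n) → ℝ) (j : Fin (D.p n)) :
    EuclideanSpace ℝ (Fin n) :=
  WithLp.toLp 2 ((√n)⁻¹ • (D.Theta n j *ᵥ η j))

theorem norm_fitOf (η : Fin (D.p n) → Fin (D.q n) → ℝ) (j : Fin (D.p n)) :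
    ‖fitOf η j‖ = 1 / √n * l2norm (D.Theta n j *ᵥ η j) := by
  rw [fitOf, WithLp.toLp_smul, norm_smul, norm_inv, Real.norm_of_nonneg (Real.sqrt_nonneg _),
    one_div]
  rfl

theorem block_signalCoef (η : Fin (D.p n) → Fin (D.q n) → ℝ) (k : D.M0 n) :
    D.block n k (signalCoef η) = fitOf η k := rfl

theorem sum_eq_sum_signal_add_sum_noise {E : Type*} [AddCommMonoid E] (f : Fin (D.p n) → E) :
    ∑ j, f j = ∑ k : D.M0 n, f k + ∑ j : {j // j ∉ D.M0 n}, f j := by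
  rw [← Fintype.sum_subtype_add_sum_subtype (fun j => j ∈ D.M0 n) f]
  congr!

theorem criterion_eq (hn : 0 < n) (e : Fin n → ℝ) (η : Fin (D.p n) → Fin (D.q n) → ℝ) :
    D.criterion n (D.response n e) η
      = 1 / 2 * ‖D.normResponse n e - (∑ k, D.block n k (signalCoef η)
          + ∑ j : {j // j ∉ D.M0 n}, fitOf η j)‖ ^ 2
        + (∑ k, D.pen n ‖D.block n k (signalCoef η)‖
          + ∑ j : {j // j ∉ D.M0 n}, D.pen n ‖fitOf η j‖) := by
  have hn' : (0 : ℝ) < n := by exact_mod_cast hn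
  simp only [block_signalCoef]
  rw [← sum_eq_sum_signal_add_sum_noise (fun j => fitOf η j),
    ← sum_eq_sum_signal_add_sum_noise (fun j => D.pen n ‖fitOf η j‖), criterion]
  simp only [norm_fitOf]
  congr 1
  have h1 : D.normResponse n e - ∑ j, fitOf η j
      = WithLp.toLp 2 ((√n)⁻¹ • (D.response n e - ∑ j, D.Theta n j *ᵥ η j)) := by
    rw [normResponse, smul_sub, WithLp.toLp_sub, Finset.smul_sum, WithLp.toLp_sum]
    rfl
  rw [h1, norm_toLp_sq, l2norm_sq, smul_dotProduct, dotProduct_smul, smul_eq_mul, smul_eq_mul,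
    ← mul_assoc (√(n : ℝ))⁻¹, ← mul_inv, Real.mul_self_sqrt hn'.le]
  field_simp

namespace RegularSample

variable (H : D.RegularSample n c₀ K δ R g τ)
include H

/-- The solution for the signal blocks, extended by zero, is a strict local minimizer of the full
criterion: a noise block enters only through its fit, which lies in the range of `noiseProj`. -/
theorem isStrictLocalMin {e : Fin n → ℝ} (he : e ∈ D.goodErrors n g τ)
    {u : EuclideanSpace ℝ (D.M0 n × Fin (D.q n))} (hu : D.IsSolution n δ e u) :
    IsStrictLocalMin (D.criterion n (D.response n e)) (fullCoef u) := by
  have hn := H.n_pos'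
  set E := D.response n e - D.ThetaM0 n *ᵥ u.ofLp with hE
  have hslope : ∀ j : {j // j ∉ D.M0 n}, ∃ t, 0 < t ∧
      l2norm (D.noiseProj n j *ᵥ E) / √n < deriv (D.pen n) t := fun j => by
    have h1 := H.ofReal_l2norm_noiseProj_lt he hu j.2
    rw [slopeAtZero, lt_iSup_iff] at h1
    obtain ⟨t, ht⟩ := h1
    rw [lt_iSup_iff] at ht
    obtain ⟨ht0, ht⟩ := ht
    exact ⟨t, ht0, (ENNReal.ofReal_lt_ofReal_iff_of_nonneg
      (div_nonneg (l2norm_nonneg _) (Real.sqrt_nonneg _))).1 ht⟩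
  obtain ⟨r, hr, hmin⟩ := hu.2.exists_strict_min H.blockDesign H.shape H.curv_lt
    (H.lt_norm_block hu) hslope
  have hsig : signalCoef (fullCoef u) = u := by
    ext k; exact fullCoef_of_mem u k.1 k.2
  have hfit : ∀ j ∉ D.M0 n, fitOf (fullCoef u) j = 0 := fun j hj => by
    rw [fitOf, fullCoef_of_notMem u hj, mulVec_zero, smul_zero, WithLp.toLp_zero]
  have hc1 : Continuous (signalCoef : (Fin (D.p n) → Fin (D.q n) → ℝ) → _) :=
    (PiLp.continuous_toLp 2 _).comp (by fun_prop)
  have hc2 : ∀ j, Continuous fun η : Fin (D.p n) → Fin (D.q n) → ℝ => fitOf η j := fun j =>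
    (PiLp.continuous_toLp 2 _).comp (by fun_prop)
  have h1 : ∀ᶠ η in 𝓝 (fullCoef u), ‖signalCoef η - u‖ < r := by
    have : Tendsto (fun η => ‖signalCoef η - u‖) (𝓝 (fullCoef u)) (𝓝 0) := by
      have := ((hc1.sub (continuous_const (y := u))).norm).tendsto (fullCoef u)
      simpa only [Pi.sub_apply, hsig, sub_self, norm_zero] using this
    exact this.eventually_lt_const hr
  have h2 : ∀ᶠ η in 𝓝 (fullCoef u), ∀ j : {j // j ∉ D.M0 n}, ‖fitOf η j‖ < r := by
    refine eventually_all.2 fun j => ?_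
    have := (hc2 j).norm.tendsto (fullCoef u)
    rw [hfit j j.2, norm_zero] at this
    exact this.eventually_lt_const hr
  rw [IsStrictLocalMin, eventually_nhdsWithin_iff]
  filter_upwards [h1, h2] with η hη1 hη2 hne
  rw [criterion_eq H.n_pos, criterion_eq H.n_pos, hsig]
  have h3 := hmin (signalCoef η) (fun j => fitOf η j) hη1 hη2 (fun j => ?_) ?_
  · refine lt_of_eq_of_lt ?_ h3
    have e1 : ∑ j : {j // j ∉ D.M0 n}, fitOf (fullCoef u) j = 0 :=
      Finset.sum_eq_zero fun j _ => hfit j j.2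
    have e2 : ∑ j : {j // j ∉ D.M0 n}, D.pen n ‖fitOf (fullCoef u) j‖
        = ∑ _j : {j // j ∉ D.M0 n}, D.pen n 0 :=
      Finset.sum_congr rfl fun j _ => by rw [hfit j j.2, norm_zero]
    rw [e1, e2, add_zero, blockCriterion]
    ring
  · have h4 : D.normResponse n e - ∑ k, D.block n k u = WithLp.toLp 2 ((√n)⁻¹ • E) := by
      rw [normResponse, sum_block, hE, smul_sub, WithLp.toLp_sub]
    rw [h4, fitOf, inner_toLp_inv_sqrt_smul]
    have h5 : E ⬝ᵥ (D.Theta n j *ᵥ η j) = (D.noiseProj n j *ᵥ E) ⬝ᵥ (D.Theta n j *ᵥ η j) := by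
      rw [mulVec_dotProduct, noiseProj_transpose, mulVec_mulVec,
        noiseProj_mul_Theta (H.noise_inv j j.2)]
    have h6 := dotProduct_le_l2norm (D.noiseProj n j *ᵥ E) (D.Theta n j *ᵥ η j)
    have h7 := norm_fitOf η (j : Fin (D.p n))
    rw [fitOf] at h7
    rw [h5, h7]
    calc _ ≤ (n : ℝ)⁻¹ * (l2norm (D.noiseProj n j *ᵥ E) * l2norm (D.Theta n j *ᵥ η j)) := by
          gcongr
      _ = (√n * √n)⁻¹ * (l2norm (D.noiseProj n j *ᵥ E) * l2norm (D.Theta n j *ᵥ η j)) := by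
          rw [Real.mul_self_sqrt hn.le]
      _ = _ := by rw [mul_inv]; ring
  · by_contra hcon
    push Not at hcon
    refine hne (funext fun j => ?_)
    by_cases hj : j ∈ D.M0 n
    · ext l
      have := congrArg (fun v : EuclideanSpace ℝ (D.M0 n × Fin (D.q n)) => v (⟨j, hj⟩, l)) hcon.1
      simp only [signalCoef] at this
      rw [this, ← fullCoef_of_mem]
    · have h4 : ‖fitOf η j‖ = 0 := by rw [hcon.2 ⟨j, hj⟩, norm_zero]
      rw [norm_fitOf, mul_eq_zero, or_iff_right (by positivity), l2norm_eq_zero] at h4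
      have h5 : ((D.Theta n j)ᵀ * D.Theta n j) *ᵥ η j = 0 := by
        rw [← mulVec_mulVec, h4, mulVec_zero]
      have h6 := (isUnit_iff_isUnit_det _).1 (H.noise_inv j hj)
      rw [fullCoef_of_notMem u hj, ← one_mulVec (η j), ← nonsing_inv_mul _ h6, ← mulVec_mulVec, h5,
        mulVec_zero]

/-- Up to a deterministic error, the pivot is a linear statistic in the errors, with a unit vector
of weights. -/
theorem abs_dotProduct_pivot_sub_le {e : Fin n → ℝ}
    {u : EuclideanSpace ℝ (D.M0 n × Fin (D.q n))} (hu : D.IsSolution n δ e u)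
    {c : D.M0 n × Fin (D.q n) → ℝ} (hc : c ⬝ᵥ c = 1) :
    |c ⬝ᵥ D.pivot n (fullCoef u)
        - ((D.ThetaM0 n * (CFC.sqrt (D.gramM0 n))⁻¹) *ᵥ c) ⬝ᵥ e|
      ≤ √n * R + √n / (c₀ * √c₀)
        * ((K + deriv (D.pen n) (D.a n / 2) / (D.a n / 2)) * δ) := by
  have hn := H.n_pos'
  have hsn : 0 < √(n : ℝ) := Real.sqrt_pos.2 hn
  have hc0 := H.c_pos
  have hsc : 0 < √c₀ := Real.sqrt_pos.2 hc0
  set S := CFC.sqrt (D.gramM0 n) with hS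
  have hSdet : IsUnit S.det := isUnit_det_sqrt_gram H.isUnit_gramM0
  have hSt : Sᵀ = S := transpose_sqrt_gram _
  have hSS : S * S = D.gramM0 n := sqrt_gram_mul_self _
  set h := S⁻¹ *ᵥ c with hh
  have hmove : ∀ x, c ⬝ᵥ (S⁻¹ *ᵥ x) = h ⬝ᵥ x := fun x => by
    rw [hh, mulVec_dotProduct, transpose_nonsing_inv, hSt]
  have hV : (D.ThetaM0 n * S⁻¹) *ᵥ c = D.ThetaM0 n *ᵥ h := by rw [hh, mulVec_mulVec]
  have hnorm : l2norm (D.ThetaM0 n *ᵥ h) = 1 := by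
    have hVV : (D.ThetaM0 n * S⁻¹)ᵀ * (D.ThetaM0 n * S⁻¹) = 1 :=
      whitened_transpose_mul_self H.isUnit_gramM0
    rw [← hV, l2norm_isometry_mulVec hVV]
    have := l2norm_sq c
    rw [hc] at this
    exact (pow_eq_one_iff_of_nonneg (l2norm_nonneg c) two_ne_zero).1 this
  have hhnorm : l2norm h ≤ 1 / (√c₀ * √n) := by
    have h1 := (H.eig h).1
    rw [hnorm, ← l2norm_sq] at h1
    rw [le_div_iff₀ (by positivity)]
    refine le_of_sq_le_sq ?_ zero_le_one
    rw [mul_pow, mul_pow, Real.sq_sqrt hc0.le, Real.sq_sqrt hn.le]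
    linarith
  have e1 : S *ᵥ (u.ofLp - D.trueCoef n)
      = S⁻¹ *ᵥ ((D.ThetaM0 n)ᵀ *ᵥ (D.approxError n + e) - (n : ℝ) • D.penGradient n u.ofLp) := by
    rw [← H.gramM0_mulVec_sub hu, mulVec_mulVec, ← hSS, ← Matrix.mul_assoc,
      nonsing_inv_mul _ hSdet, Matrix.one_mul]
  have e2 : (fun k : D.M0 n × Fin (D.q n) => fullCoef u k.1 k.2 - D.eta0 n k.1 k.2)
      = u.ofLp - D.trueCoef n := by
    ext k; rw [fullCoef_of_mem]; rfl
  have e3 : c ⬝ᵥ D.pivot n (fullCoef u) = (D.ThetaM0 n *ᵥ h) ⬝ᵥ (D.approxError n + e)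
      + n * (h ⬝ᵥ D.v0 n - h ⬝ᵥ D.penGradient n u.ofLp) := by
    rw [pivot, e2, ← hS, e1, dotProduct_add, dotProduct_smul, hmove, hmove, dotProduct_sub,
      ← mulVec_dotProduct, dotProduct_smul, smul_eq_mul, smul_eq_mul]
    ring
  rw [← penGradient_trueCoef] at e3
  have h1 : |h ⬝ᵥ D.penGradient n (D.trueCoef n) - h ⬝ᵥ D.penGradient n u.ofLp|
      ≤ (K + deriv (D.pen n) (D.a n / 2) / (D.a n / 2)) * (c₀⁻¹ * (δ * (1 / (√c₀ * √n)))) := by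
    have h2 := H.blockDesign.abs_sum_deriv_sub_le H.shape two_mul_le_norm_block_center
      (H.le_norm_block hu) (WithLp.toLp 2 h)
    rw [← dotProduct_penGradient, ← dotProduct_penGradient] at h2
    refine h2.trans (mul_le_mul_of_nonneg_left ?_ ?_)
    · refine mul_le_mul_of_nonneg_left ?_ (by positivity)
      exact mul_le_mul hu.1 hhnorm (norm_nonneg _) H.radius_pos.le
    · have := H.shape.pos
      have := H.shape.deriv_nonneg _ H.shape.pos
      have := H.shape.curv_nonneg
      positivity
  have h2 : |(D.ThetaM0 n *ᵥ h) ⬝ᵥ D.approxError n| ≤ √n * R := by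
    refine (abs_dotProduct_le_l2norm _ _).trans ?_
    rw [hnorm, one_mul]; exact H.approx
  rw [e3, hV, dotProduct_add]
  have e4 : (D.ThetaM0 n *ᵥ h) ⬝ᵥ D.approxError n + (D.ThetaM0 n *ᵥ h) ⬝ᵥ e
      + n * (h ⬝ᵥ D.penGradient n (D.trueCoef n) - h ⬝ᵥ D.penGradient n u.ofLp)
      - (D.ThetaM0 n *ᵥ h) ⬝ᵥ e
      = (D.ThetaM0 n *ᵥ h) ⬝ᵥ D.approxError n
        + n * (h ⬝ᵥ D.penGradient n (D.trueCoef n) - h ⬝ᵥ D.penGradient n u.ofLp) := by ring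
  rw [e4]
  refine (abs_add_le _ _).trans (add_le_add h2 ?_)
  rw [abs_mul, abs_of_pos hn]
  calc _ ≤ (n : ℝ) * ((K + deriv (D.pen n) (D.a n / 2) / (D.a n / 2))
          * (c₀⁻¹ * (δ * (1 / (√c₀ * √n))))) := by gcongr
    _ = (√n * √n) * ((K + deriv (D.pen n) (D.a n / 2) / (D.a n / 2))
          * (c₀⁻¹ * (δ * (1 / (√c₀ * √n))))) := by rw [Real.mul_self_sqrt hn.le]
    _ = _ := by field_simp

end RegularSample

end LinearFAR

/-! ### Convergence in distribution and the probability of bad errors -/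

/-- A sequence that is, on events of probability tending to one, uniformly close to random variables
of law `ν`, converges in distribution to `ν`. -/
theorem tendstoInDistribution_of_abs_sub_le {Ω : ℕ → Type*} [∀ n, MeasurableSpace (Ω n)]
    {P : ∀ n, Measure (Ω n)} [∀ n, IsProbabilityMeasure (P n)] {ν : Measure ℝ}
    [IsProbabilityMeasure ν] {Y Z : ∀ n, Ω n → ℝ} {A : ∀ n, Set (Ω n)} {r : ℕ → ℝ}
    (hY : ∀ n, AEMeasurable (Y n) (P n)) (hA : ∀ n, MeasurableSet (A n))
    (hPA : Tendsto (fun n => P n (A n)) atTop (𝓝 1)) (hr : Tendsto r atTop (𝓝 0))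
    (hZ : ∀ᶠ n in atTop, HasLaw (Z n) ν (P n) ∧ ∀ ω ∈ A n, |Y n ω - Z n ω| ≤ r n) :
    TendstoInDistribution Y atTop (id : ℝ → ℝ) P ν := by
  refine ⟨hY, aemeasurable_id, ?_⟩
  refine tendsto_iff_forall_lipschitz_integral_tendsto.2 ?_
  rintro f ⟨C, hC⟩ ⟨L, hL⟩
  have hfm : Measurable f := hL.continuous.measurable
  have hPc : Tendsto (fun n => (P n).real (A n)ᶜ) atTop (𝓝 0) := by
    have h1 : ∀ n, (P n).real (A n)ᶜ = 1 - (P n).real (A n) := fun n =>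
      probReal_compl_eq_one_sub (hA n)
    have h2 := (ENNReal.tendsto_toReal ENNReal.one_ne_top).comp hPA
    simp_rw [h1]
    simpa [Measure.real, Function.comp_def] using h2.const_sub 1
  have hbd : ∀ x, ‖f x‖ ≤ |f 0| + C := fun x => by
    have := hC x 0
    rw [Real.dist_eq] at this
    rw [Real.norm_eq_abs]
    have h3 := abs_sub_abs_le_abs_sub (f x) (f 0)
    linarith
  rw [tendsto_iff_norm_sub_tendsto_zero]
  have hlim : Tendsto (fun n => L * |r n| + C * (P n).real (A n)ᶜ) atTop (𝓝 0) := by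
    simpa using (hr.abs.const_mul (L : ℝ)).add (hPc.const_mul C)
  refine squeeze_zero' (Eventually.of_forall fun _ => norm_nonneg _) ?_ hlim
  filter_upwards [hZ] with n ⟨hlaw, hclose⟩
  change ‖∫ x, f x ∂((P n).map (Y n)) - ∫ x, f x ∂(ν.map id)‖ ≤ _
  have hint : ∀ W : Ω n → ℝ, AEMeasurable W (P n) → Integrable (fun ω => f (W ω)) (P n) :=
    fun W hW => Integrable.of_bound (hfm.comp_aemeasurable hW).aestronglyMeasurable _
      (ae_of_all _ fun ω => hbd (W ω))
  rw [Measure.map_id, ← hlaw.map_eq, integral_map (hY n) hfm.aestronglyMeasurable,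
    integral_map hlaw.aemeasurable hfm.aestronglyMeasurable,
    ← integral_sub (hint _ (hY n)) (hint _ hlaw.aemeasurable)]
  have hg : Integrable (fun ω => L * |r n| + (A n)ᶜ.indicator (fun _ => C) ω) (P n) :=
    (integrable_const _).add ((integrable_const C).indicator (hA n).compl)
  have hle : ∀ ω, ‖f (Y n ω) - f (Z n ω)‖
      ≤ L * |r n| + (A n)ᶜ.indicator (fun _ => C) ω := fun ω => by
    by_cases hω : ω ∈ A n
    · rw [Set.indicator_of_notMem (by simpa using hω), add_zero, ← dist_eq_norm]
      refine (hL.dist_le_mul _ _).trans (mul_le_mul_of_nonneg_left ?_ L.coe_nonneg)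
      rw [Real.dist_eq]
      exact (hclose ω hω).trans (le_abs_self _)
    · rw [Set.indicator_of_mem hω, ← dist_eq_norm]
      have : 0 ≤ L * |r n| := mul_nonneg L.coe_nonneg (abs_nonneg _)
      linarith [hC (Y n ω) (Z n ω)]
  refine (norm_integral_le_of_norm_le hg (ae_of_all _ hle)).trans_eq ?_
  rw [integral_add (integrable_const _) ((integrable_const C).indicator (hA n).compl),
    integral_const, integral_indicator_const C (hA n).compl]
  simp [mul_comm]

namespace LinearFAR

variable {D : LinearFAR} {n : ℕ} {c₀ K δ R g τ : ℝ}

/-- Errors are good with high probability: Chebyshev's inequality handles the signal columns, and an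
exponential bound the projections onto the noise blocks, of which there are at most `p_n`. -/
theorem RegularSample.measure_notMem_goodErrors_le (H : D.RegularSample n c₀ K δ R g τ)
    (hg : 0 < g) {Ω : Type*} [MeasurableSpace Ω] {P : Measure Ω} {ε : Fin n → Ω → ℝ} {σ : ℝ≥0}
    (hind : iIndepFun ε P) (hlaw : ∀ i, HasLaw (ε i) (gaussianReal 0 (σ ^ 2)) P) :
    P {ω | (fun i => ε i ω) ∉ D.goodErrors n g τ}
      ≤ ENNReal.ofReal (σ ^ 2 * (D.s n * D.q n * n) / (n * g) ^ 2)
        + D.p n * ENNReal.ofReal (Real.exp (D.q n - τ / (4 * (σ ^ 2 + 1)))) := by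
  classical
  have hn := H.n_pos'
  have hsub : {ω | (fun i => ε i ω) ∉ D.goodErrors n g τ} ⊆
      {ω | (n * g) ^ 2 ≤ ((D.ThetaM0 n)ᵀ *ᵥ fun i => ε i ω) ⬝ᵥ ((D.ThetaM0 n)ᵀ *ᵥ fun i => ε i ω)} ∪
      ⋃ j : {j // j ∉ D.M0 n}, {ω | τ ≤ l2norm ((D.noiseProj n j * (1 - D.signalProj n)) *ᵥ
        fun i => ε i ω) ^ 2} := by
    intro ω hω
    by_contra hcon
    rw [Set.mem_union, not_or, Set.mem_iUnion] at hcon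
    push Not at hcon
    refine hω ⟨?_, Set.mem_iInter.2 fun j => ?_⟩
    · have h1 := hcon.1
      simp only [Set.mem_ofPred_eq, not_le, ← l2norm_sq] at h1
      exact lt_of_pow_lt_pow_left₀ 2 (by positivity) h1
    · have h1 := hcon.2 j
      simpa using h1
  refine (measure_mono hsub).trans ((measure_union_le _ _).trans (add_le_add ?_ ?_))
  · refine (measure_sq_mulVec_ge_le_div hind hlaw _ (by positivity)).trans_eq ?_
    have h1 : ∑ k, (D.ThetaM0 n)ᵀ k ⬝ᵥ (D.ThetaM0 n)ᵀ k = D.s n * D.q n * n := by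
      have h2 : ∀ k : D.M0 n × Fin (D.q n), (D.ThetaM0 n)ᵀ k ⬝ᵥ (D.ThetaM0 n)ᵀ k = n := fun k => by
        rw [← Theta_col_sq H.n_pos (H.scale_ne k.1 k.2)]
        simp [dotProduct, ThetaM0, sq]
      simp_rw [h2]
      simp [s]
    rw [h1]
  · refine (measure_iUnion_fintype_le _ _).trans ?_
    have hj : ∀ j : {j // j ∉ D.M0 n}, P {ω | τ ≤ l2norm ((D.noiseProj n j
        * (1 - D.signalProj n)) *ᵥ fun i => ε i ω) ^ 2}
        ≤ ENNReal.ofReal (Real.exp (D.q n - τ / (4 * (σ ^ 2 + 1)))) := by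
      intro j
      set V := D.Theta n j * (CFC.sqrt ((D.Theta n j)ᵀ * D.Theta n j))⁻¹ with hVdef
      have hV : Vᵀ * V = 1 := whitened_transpose_mul_self (H.noise_inv j j.2)
      have hsym : (1 - D.signalProj n)ᵀ = 1 - D.signalProj n := by
        rw [signalProj, transpose_sub, transpose_one, transpose_mul, transpose_mul,
          transpose_nonsing_inv, transpose_transpose, gramM0, transpose_mul, transpose_transpose,
          Matrix.mul_assoc]
      have h1 := measure_sq_mulVec_ge_le hind hlaw (Vᵀ * (1 - D.signalProj n)) (fun x => ?_)
        (τ / (4 * (σ ^ 2 + 1)))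
      · rw [Fintype.card_fin] at h1
        refine le_trans (measure_mono fun ω hω => ?_) h1
        have h2 : (D.noiseProj n j * (1 - D.signalProj n)) *ᵥ (fun i => ε i ω)
            = V *ᵥ ((Vᵀ * (1 - D.signalProj n)) *ᵥ fun i => ε i ω) := by
          rw [mulVec_mulVec, ← Matrix.mul_assoc, hVdef, whitened_mul_transpose, noiseProj]
        simp only [Set.mem_ofPred_eq] at hω ⊢
        rw [h2, l2norm_isometry_mulVec hV, l2norm_sq] at hω
        refine le_trans (le_of_eq ?_) hω
        field_simp
      · rw [← mulVec_transpose, transpose_mul, hsym, transpose_transpose, ← l2norm_sq, ← l2norm_sq,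
          ← mulVec_mulVec]
        refine pow_le_pow_left₀ (l2norm_nonneg _) ?_ 2
        exact (H.l2norm_one_sub_signalProj_mulVec_le _).trans (l2norm_isometry_mulVec hV x).le
    refine (Finset.sum_le_sum fun j _ => hj j).trans ?_
    rw [Finset.sum_const, nsmul_eq_mul]
    gcongr
    have := Fintype.card_subtype_le fun j : Fin (D.p n) => j ∉ D.M0 n
    rw [Fintype.card_fin] at this
    rwa [Finset.card_univ]

end LinearFAR

/-! ### Growth rates -/

theorem tendsto_zero_of_eventually_abs_le {f : ℕ → ℝ} (h : ∀ ε > 0, ∀ᶠ n in atTop, |f n| ≤ ε) :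
    Tendsto f atTop (𝓝 0) := by
  rw [Metric.tendsto_nhds]
  intro ε hε
  filter_upwards [h (ε / 2) (by positivity)] with n hn
  rw [Real.dist_eq, sub_zero]
  linarith

namespace LinearFAR

variable {D : LinearFAR} {α : ℝ}

section Sizes

variable {n : ℕ} (ha : 0 < D.a n)
include ha

theorem nonempty_M0_of_pos : Nonempty (D.M0 n) := by
  by_contra h
  rw [not_nonempty_iff] at h
  rw [a, Real.iInf_of_isEmpty] at ha
  exact lt_irrefl _ ha

theorem s_pos_of_pos : 1 ≤ D.s n := by
  obtain ⟨k⟩ := nonempty_M0_of_pos ha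
  exact Finset.card_pos.2 ⟨k, k.2⟩

theorem p_pos_of_pos : 1 ≤ D.p n := by
  obtain ⟨k⟩ := nonempty_M0_of_pos ha
  exact k.1.pos

theorem q_pos_of_pos : 1 ≤ D.q n := by
  obtain ⟨k⟩ := nonempty_M0_of_pos ha
  by_contra h
  have hq : IsEmpty (Fin (D.q n)) := by
    rw [← Fintype.card_eq_zero_iff, Fintype.card_fin]; omega
  have h1 := a_le k
  have h2 : D.Theta n k *ᵥ D.eta0 n k = 0 := by
    ext i; simp [mulVec, dotProduct]
  rw [h2, l2norm_eq_zero.2 rfl, zero_div] at h1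
  linarith

end Sizes

theorem ModelCondition.eventually_lt_a (hM : D.ModelCondition α) (x : ℝ) :
    ∀ᶠ n : ℕ in atTop, x * (n : ℝ) ^ (-α) < D.a n := by
  filter_upwards [hM.signal.eventually_gt_atTop x, eventually_gt_atTop 0] with n h1 h2
  have hn : (0 : ℝ) < n := by exact_mod_cast h2
  rw [Real.rpow_neg hn.le, ← div_eq_mul_inv, div_lt_iff₀ (by positivity)]
  linarith

theorem ModelCondition.eventually_a_pos (hM : D.ModelCondition α) : ∀ᶠ n in atTop, 0 < D.a n := by
  simpa using hM.eventually_lt_a 0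

theorem ModelCondition.deriv_nonneg (hM : D.ModelCondition α) (n : ℕ) {t : ℝ} (ht : 0 < t) :
    0 ≤ deriv (D.pen n) t := by
  have h1 := hM.mono (D.lam n) (hM.lam_pos n)
  have h2 : MonotoneOn (D.pen n) (Set.Ioi 0) := h1.mono Set.Ioi_subset_Ici_self
  rw [← derivWithin_of_isOpen isOpen_Ioi ht]
  exact h2.derivWithin_nonneg

theorem ModelCondition.penaltyShape (hM : D.ModelCondition α) {n : ℕ} {K : ℝ} (hK : 0 ≤ K)
    (ha : 0 < D.a n)
    (hdiff : ∀ t : ℝ, D.a n / 2 ≤ t → DifferentiableAt ℝ (deriv (D.pen n)) t)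
    (hcurv : D.curvature n ≤ ENNReal.ofReal K) : PenaltyShape (D.pen n) (D.a n / 2) K where
  pos := by positivity
  curv_nonneg := hK
  concave := hM.concave _ (hM.lam_pos n)
  diff := hM.diff _ (hM.lam_pos n)
  deriv_nonneg := fun _ => hM.deriv_nonneg n
  anti := hM.deriv_anti _ (hM.lam_pos n)
  diff_deriv := hdiff
  curv := fun t ht => by
    have h1 : ENNReal.ofReal |deriv (deriv (D.pen n)) t| ≤ D.curvature n :=
      le_iSup₂ (f := fun (t : ℝ) (_ : D.a n / 2 ≤ t) =>
        ENNReal.ofReal |deriv (deriv (D.pen n)) t|) t ht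
    exact (ENNReal.ofReal_le_ofReal_iff hK).1 (h1.trans hcurv)

theorem eig_of_spectrum {n : ℕ} (hn : 0 < n) {c₀ : ℝ}
    (h : spectrum ℝ ((n : ℝ)⁻¹ • D.gramM0 n) ⊆ Set.Icc c₀ c₀⁻¹)
    (x : D.M0 n × Fin (D.q n) → ℝ) : c₀ * n * (x ⬝ᵥ x) ≤ l2norm (D.ThetaM0 n *ᵥ x) ^ 2 ∧
    l2norm (D.ThetaM0 n *ᵥ x) ^ 2 ≤ n / c₀ * (x ⬝ᵥ x) := by
  have hn' : (0 : ℝ) < n := by exact_mod_cast hn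
  have hherm : ((n : ℝ)⁻¹ • D.gramM0 n).IsHermitian := by
    have hG : (D.gramM0 n)ᴴ = D.gramM0 n :=
      (posSemidef_transpose_mul_self (D.ThetaM0 n)).isHermitian.eq
    rw [Matrix.IsHermitian, conjTranspose_smul, star_trivial, hG]
  have h1 := dotProduct_mulVec_mem_Icc_of_spectrum_subset hherm h x
  have h2 : x ⬝ᵥ (((n : ℝ)⁻¹ • D.gramM0 n) *ᵥ x) = (n : ℝ)⁻¹ * l2norm (D.ThetaM0 n *ᵥ x) ^ 2 := by
    rw [smul_mulVec, dotProduct_smul, smul_eq_mul, l2norm_sq, mulVec_dotProduct_mulVec]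
    rfl
  rw [h2, inv_mul_eq_div, le_div_iff₀ hn', div_le_iff₀ hn'] at h1
  exact ⟨by linarith [h1.1], h1.2.trans_eq (by rw [div_eq_mul_inv]; ring)⟩

section Rates

variable (hM : D.ModelCondition α) {κ : ℝ} (hS : D.SelectionRates α κ) (hN : D.NormalityRates α)

include hN in
theorem NormalityRates.eventually_approx_le {x : ℝ} (hx : 0 < x) : ∀ᶠ n : ℕ in atTop,
    (D.s n : ℝ) * ((D.q n : ℝ) ^ 2)⁻¹ ≤ x * (n : ℝ) ^ (-(1 / 2) : ℝ) := by
  filter_upwards [hN.approx.def hx] with n h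
  rwa [Real.norm_of_nonneg (by positivity), Real.norm_of_nonneg (by positivity)] at h

include hM hN in
theorem tendsto_q_atTop : Tendsto (fun n => (D.q n : ℝ)) atTop atTop := by
  have h1 : Tendsto (fun n : ℕ => (n : ℝ) ^ (1 / 4 : ℝ)) atTop atTop :=
    (tendsto_rpow_atTop (by norm_num)).comp tendsto_natCast_atTop_atTop
  refine tendsto_atTop_mono' _ ?_ h1
  filter_upwards [hN.eventually_approx_le one_pos, hM.eventually_a_pos, eventually_gt_atTop 0]
    with n h2 ha hn
  have hn' : (0 : ℝ) < n := by exact_mod_cast hn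
  have hs : (1 : ℝ) ≤ D.s n := by exact_mod_cast s_pos_of_pos ha
  have hq : (0 : ℝ) < D.q n := by exact_mod_cast q_pos_of_pos ha
  have h3 : ((D.q n : ℝ) ^ 2)⁻¹ ≤ ((n : ℝ) ^ (1 / 2 : ℝ))⁻¹ := by
    rw [← Real.rpow_neg hn'.le]
    have : ((D.q n : ℝ) ^ 2)⁻¹ ≤ (D.s n : ℝ) * ((D.q n : ℝ) ^ 2)⁻¹ :=
      le_mul_of_one_le_left (by positivity) hs
    linarith
  rw [inv_le_inv₀ (by positivity) (by positivity)] at h3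
  refine le_of_sq_le_sq ?_ hq.le
  refine le_trans (le_of_eq ?_) h3
  rw [← Real.rpow_natCast, ← Real.rpow_mul hn'.le]
  norm_num

include hM hS hN in
/-- The stochastic error of the signal coefficients is negligible; here the logarithm in the
dimension condition is bounded below, since `q_n → ∞`. -/
theorem tendsto_s_mul_q : Tendsto (fun n : ℕ => (D.s n : ℝ) * D.q n * (n : ℝ) ^ (2 * α - 1))
    atTop (𝓝 0) := by
  refine tendsto_zero_of_eventually_abs_le fun ε hε => ?_
  filter_upwards [hS.dim.def (mul_pos hε (Real.log_pos one_lt_two)),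
    (tendsto_q_atTop hM hN).eventually_ge_atTop 2, hM.eventually_a_pos, eventually_gt_atTop 0]
    with n h1 hq2 ha hn
  have hn' : (0 : ℝ) < n := by exact_mod_cast hn
  have hp : (1 : ℝ) ≤ D.p n := by exact_mod_cast p_pos_of_pos ha
  have hs : (1 : ℝ) ≤ D.s n := by exact_mod_cast s_pos_of_pos ha
  have hlog : Real.log 2 ≤ Real.log ((D.p n : ℝ) * D.q n) :=
    Real.log_le_log (by norm_num) (by nlinarith)
  have hl2 : 0 < Real.log 2 := Real.log_pos one_lt_two
  rw [Real.norm_of_nonneg (by linarith), Real.norm_of_nonneg (by positivity)] at h1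
  have h2 : (D.s n : ℝ) * (D.q n : ℝ) ^ 2 * (n : ℝ) ^ (2 * α - 1) ≤ ε := by
    have h3 : Real.log 2 ≤ ε * Real.log 2
        * ((n : ℝ) ^ (1 - 2 * α) * (D.s n : ℝ)⁻¹ * ((D.q n : ℝ) ^ 2)⁻¹) := hlog.trans h1
    have h4 : (n : ℝ) ^ (2 * α - 1) * (n : ℝ) ^ (1 - 2 * α) = 1 := by
      rw [← Real.rpow_add hn']; norm_num
    have h5 : 0 < (n : ℝ) ^ (2 * α - 1) := by positivity
    have h6 := mul_le_mul_of_nonneg_right h3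
      (by positivity : 0 ≤ (D.s n : ℝ) * (D.q n : ℝ) ^ 2 * (n : ℝ) ^ (2 * α - 1))
    have h7 : ε * Real.log 2 * ((n : ℝ) ^ (1 - 2 * α) * (D.s n : ℝ)⁻¹ * ((D.q n : ℝ) ^ 2)⁻¹)
        * ((D.s n : ℝ) * (D.q n : ℝ) ^ 2 * (n : ℝ) ^ (2 * α - 1))
        = ε * Real.log 2 * ((n : ℝ) ^ (2 * α - 1) * (n : ℝ) ^ (1 - 2 * α)) := by
      field_simp
    rw [h7, h4, mul_one, mul_comm ε] at h6
    exact le_of_mul_le_mul_left h6 hl2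
  rw [abs_of_nonneg (by positivity)]
  refine le_trans ?_ h2
  gcongr
  nlinarith

theorem rpow_neg_half_le {n : ℕ} (hn : 0 < n) (hα : α ≤ 1 / 2) :
    (n : ℝ) ^ (-(1 / 2) : ℝ) ≤ (n : ℝ) ^ (-α) :=
  Real.rpow_le_rpow_of_exponent_le (by exact_mod_cast hn) (by linarith)

include hM in
theorem ModelCondition.eventually_sqrt_s_mul_deriv_le {x : ℝ} (hx : 0 < x) : ∀ᶠ n : ℕ in atTop,
    √(D.s n) * deriv (D.pen n) (D.a n / 2) ≤ x * (n : ℝ) ^ (-α) := by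
  filter_upwards [hM.deriv_small.def hx, hM.eventually_a_pos, eventually_gt_atTop 0] with n h1 ha hn
  have hn' : (0 : ℝ) < n := by exact_mod_cast hn
  have hs : (0 : ℝ) < D.s n := by exact_mod_cast s_pos_of_pos ha
  have hq : (1 : ℝ) ≤ D.q n := by exact_mod_cast q_pos_of_pos ha
  rw [Real.norm_of_nonneg (hM.deriv_nonneg n (by positivity)),
    Real.norm_of_nonneg (by positivity)] at h1
  have h2 : √(D.s n) * (D.s n : ℝ) ^ (-(1 / 2) : ℝ) = 1 := by
    rw [Real.sqrt_eq_rpow, ← Real.rpow_add hs]; norm_num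
  calc _ ≤ √(D.s n) * (x * ((n : ℝ) ^ (-α) * (D.q n : ℝ)⁻¹ * (D.s n : ℝ) ^ (-(1 / 2) : ℝ))) := by
        gcongr
    _ = x * (n : ℝ) ^ (-α) * (D.q n : ℝ)⁻¹ * (√(D.s n) * (D.s n : ℝ) ^ (-(1 / 2) : ℝ)) := by ring
    _ ≤ x * (n : ℝ) ^ (-α) * 1 * 1 := by
        rw [h2]
        gcongr
        exact inv_le_one_of_one_le₀ hq
    _ = _ := by ring

end Rates

/-- The noise level is below half the slope of the penalty at zero: the constant
`κ = 1 / (128 (σ² + 1))` makes the Gaussian part at most a quarter of the slope, and the truncation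
error is of smaller order than `n^{-1/2}`, hence than the slope. -/
theorem ofReal_noise_lt {n : ℕ} (hn : 0 < n) {v m q R : ℝ} {S : ℝ≥0∞} (hv : 0 < v) (hm : 0 ≤ m)
    (hq : 1 ≤ q) (hS : 0 < S) (hR : R ≤ 1 / 8 * (n : ℝ) ^ (-(1 / 2) : ℝ) * √(128 * v))
    (hnoise : ENNReal.ofReal (q + m) ≤ ENNReal.ofReal (1 / (128 * v) * n) * S ^ 2) :
    ENNReal.ofReal (√(8 * v * (q + m)) / √n + R) < S / 2 := by
  have hn' : (0 : ℝ) < n := by exact_mod_cast hn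
  have hsn : 0 < √(n : ℝ) := Real.sqrt_pos.2 hn'
  rcases eq_or_ne S ⊤ with htop | htop
  · rw [htop, ENNReal.top_div_of_ne_top (by simp)]; exact ENNReal.ofReal_lt_top
  obtain ⟨x, rfl⟩ : ∃ x : ℝ, S = ENNReal.ofReal x := ⟨S.toReal, (ENNReal.ofReal_toReal htop).symm⟩
  have hx : 0 < x := ENNReal.ofReal_pos.1 hS
  rw [← ENNReal.ofReal_pow hx.le, ← ENNReal.ofReal_mul (by positivity),
    ENNReal.ofReal_le_ofReal_iff (by positivity)] at hnoise
  have h1 : √(8 * v * (q + m)) / √n ≤ x / 4 := by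
    rw [div_le_iff₀ hsn]
    refine Real.sqrt_le_iff.2 ⟨by positivity, ?_⟩
    rw [mul_pow, Real.sq_sqrt hn'.le]
    calc _ ≤ 8 * v * (1 / (128 * v) * n * x ^ 2) := by gcongr
      _ = _ := by field_simp; norm_num
  have h2 : (n : ℝ) ^ (-(1 / 2) : ℝ) * √(128 * v) ≤ x := by
    refine le_of_sq_le_sq ?_ hx.le
    rw [mul_pow, Real.sq_sqrt (by positivity), ← Real.rpow_natCast, ← Real.rpow_mul hn'.le]
    have h3 : 1 ≤ 1 / (128 * v) * n * x ^ 2 := by linarith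
    have h4 : (n : ℝ) ^ (-(1 / 2) * ((2 : ℕ) : ℝ) : ℝ) = (n : ℝ)⁻¹ := by
      rw [← Real.rpow_neg_one]; norm_num
    rw [h4]
    calc (n : ℝ)⁻¹ * (128 * v) ≤ (n : ℝ)⁻¹ * (128 * v) * (1 / (128 * v) * n * x ^ 2) :=
          le_mul_of_one_le_right (by positivity) h3
      _ = x ^ 2 := by field_simp
  rw [← ENNReal.ofReal_ofNat 2, ← ENNReal.ofReal_div_of_pos (by norm_num)]
  refine (ENNReal.ofReal_lt_ofReal_iff (by positivity)).2 ?_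
  linarith

end LinearFAR

/-! ### Asymptotics and the theorem -/

namespace LinearFAR

variable {D : LinearFAR} {α : ℝ}

theorem eventually_regularSample (hB : D.BasisCondition) (hM : D.ModelCondition α) {v : ℝ}
    (hv : 0 < v) (hS : D.SelectionRates α (1 / (128 * v))) (hN : D.NormalityRates α) :
    ∃ c₀ C K : ℝ, 0 < c₀ ∧ ∀ᶠ n : ℕ in atTop,
      D.RegularSample n c₀ (K * (n : ℝ) ^ (-(1 / 2) : ℝ)) ((n : ℝ) ^ (-α))
        (C * ((D.s n : ℝ) * ((D.q n : ℝ) ^ 2)⁻¹)) (c₀ / 8 * (n : ℝ) ^ (-α))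
        (8 * v * (D.q n + Real.log (D.p n))) := by
  obtain ⟨c₀, hc₀, hdesign⟩ := hM.design
  obtain ⟨C, hC, happrox⟩ := hB.exists_l2norm_approxError_le
  obtain ⟨K, hK⟩ := hN.curvature_small
  have hα := hM.alpha_mem
  have hsc : 0 < √c₀ := Real.sqrt_pos.2 hc₀
  refine ⟨c₀, C, |K|, hc₀, ?_⟩
  -- one tolerance for the truncation error, small enough for the gradient and for the noise level
  have hx : 0 < min (c₀ / 16 * √c₀) (1 / 8 * √(128 * v)) / (C + 1) := by positivity
  have hcurv : ∀ᶠ n : ℕ in atTop, 4 * (|K| * (n : ℝ) ^ (-(1 / 2) : ℝ)) < c₀ ^ 2 := by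
    have h1 : Tendsto (fun n : ℕ => (n : ℝ) ^ (-(1 / 2) : ℝ)) atTop (𝓝 0) :=
      (tendsto_rpow_neg_atTop (by norm_num)).comp tendsto_natCast_atTop_atTop
    have h2 := (h1.const_mul |K|).const_mul 4
    rw [mul_zero, mul_zero] at h2
    exact h2.eventually_lt_const (by positivity)
  filter_upwards [hdesign, hK, hM.twice_diff, hM.scale_ne, hM.noise_inv, hS.noise_const,
    hM.eventually_a_pos, hM.eventually_lt_a (2 / √c₀), hN.eventually_approx_le hx,
    hM.eventually_sqrt_s_mul_deriv_le (x := c₀ / 8 * √c₀) (by positivity), hcurv,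
    eventually_gt_atTop 0] with n hdes hKn hdiff hsc_ne hinv hnoise ha hasig hap hderiv hKc hn
  have hn' : (0 : ℝ) < n := by exact_mod_cast hn
  have hq : (1 : ℝ) ≤ D.q n := by exact_mod_cast q_pos_of_pos ha
  have hpow : (0 : ℝ) < (n : ℝ) ^ (-(1 / 2) : ℝ) := by positivity
  have hpowα : (0 : ℝ) < (n : ℝ) ^ (-α) := by positivity
  have hR : C * ((D.s n : ℝ) * ((D.q n : ℝ) ^ 2)⁻¹)
      ≤ min (c₀ / 16 * √c₀) (1 / 8 * √(128 * v)) * (n : ℝ) ^ (-(1 / 2) : ℝ) := by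
    have h1 : 0 ≤ (D.s n : ℝ) * ((D.q n : ℝ) ^ 2)⁻¹ := by positivity
    calc _ ≤ (C + 1) * ((D.s n : ℝ) * ((D.q n : ℝ) ^ 2)⁻¹) := by gcongr; linarith
      _ ≤ (C + 1) * (min (c₀ / 16 * √c₀) (1 / 8 * √(128 * v)) / (C + 1)
          * (n : ℝ) ^ (-(1 / 2) : ℝ)) := by gcongr
      _ = _ := by field_simp
  have hR1 : C * ((D.s n : ℝ) * ((D.q n : ℝ) ^ 2)⁻¹) ≤ c₀ / 16 * √c₀ * (n : ℝ) ^ (-α) := by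
    refine hR.trans (mul_le_mul (min_le_left _ _) (rpow_neg_half_le hn hα.2.le) hpow.le
      (by positivity))
  refine
    { n_pos := hn
      nonempty := ?_
      shape := hM.penaltyShape (by positivity) ha hdiff (hKn.trans ?_)
      c_pos := hc₀
      curv_lt := hKc
      eig := eig_of_spectrum hn hdes.1
      scale_ne := hsc_ne
      noise_inv := hinv
      incoherent := hdes.2
      radius_pos := hpowα
      radius_lt := ?_
      approx_nonneg := by positivity
      approx := happrox n (q_pos_of_pos ha) hsc_ne
      grad := ?_
      noise := ?_ }
  · obtain ⟨k⟩ := nonempty_M0_of_pos ha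
    exact ⟨k, ⟨0, q_pos_of_pos ha⟩⟩
  · exact ENNReal.ofReal_le_ofReal (mul_le_mul_of_nonneg_right (le_abs_self K) hpow.le)
  · rw [div_mul_eq_mul_div, div_lt_iff₀ hsc] at hasig
    linarith
  · have h1 : C * ((D.s n : ℝ) * ((D.q n : ℝ) ^ 2)⁻¹) / √c₀ ≤ c₀ / 16 * (n : ℝ) ^ (-α) := by
      rw [div_le_iff₀ hsc]; linarith
    have h2 : √(D.s n) / √c₀ * deriv (D.pen n) (D.a n / 2) ≤ c₀ / 8 * (n : ℝ) ^ (-α) := by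
      rw [div_mul_eq_mul_div, div_le_iff₀ hsc]; linarith
    nlinarith
  · refine ofReal_noise_lt hn hv (Real.log_natCast_nonneg _) hq
      (hM.slope_pos _ (hM.lam_pos n)) (hR.trans ?_) hnoise
    calc _ ≤ 1 / 8 * √(128 * v) * (n : ℝ) ^ (-(1 / 2) : ℝ) := by gcongr; exact min_le_right _ _
      _ = _ := by ring

/-- The bound on the probability of bad errors tends to zero: `q_n → ∞` beats the union bound over
the predictors, because the threshold contains `log p_n`. -/
theorem tendsto_badProb (hM : D.ModelCondition α) {κ : ℝ} (hS : D.SelectionRates α κ)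
    (hN : D.NormalityRates α) {c₀ w : ℝ} (hc₀ : 0 < c₀) :
    Tendsto (fun n : ℕ => ENNReal.ofReal (w ^ 2 * (D.s n * D.q n * n)
          / (n * (c₀ / 8 * (n : ℝ) ^ (-α))) ^ 2)
        + D.p n * ENNReal.ofReal (Real.exp (D.q n
          - 8 * (w ^ 2 + 1) * (D.q n + Real.log (D.p n)) / (4 * (w ^ 2 + 1))))) atTop (𝓝 0) := by
  have h1 : Tendsto (fun n : ℕ => ENNReal.ofReal (w ^ 2 * (D.s n * D.q n * n)
      / (n * (c₀ / 8 * (n : ℝ) ^ (-α))) ^ 2)) atTop (𝓝 0) := by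
    have h2 := (tendsto_s_mul_q hM hS hN).const_mul (w ^ 2 * 64 / c₀ ^ 2)
    rw [mul_zero] at h2
    rw [← ENNReal.ofReal_zero]
    refine (ENNReal.tendsto_ofReal h2).congr' ?_
    filter_upwards [eventually_gt_atTop 0] with n hn
    have hn' : (0 : ℝ) < n := by exact_mod_cast hn
    congr 1
    have h3 : (n : ℝ) ^ (2 * α - 1) * ((n : ℝ) ^ (-α)) ^ 2 * n = 1 := by
      rw [← Real.rpow_natCast, ← Real.rpow_mul hn'.le, ← Real.rpow_add hn',
        ← Real.rpow_add_one hn'.ne']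
      norm_num
      ring_nf
      simp
    have h4 : 0 < (n : ℝ) ^ (-α) := by positivity
    rw [eq_div_iff (by positivity)]
    calc _ = w ^ 2 * (D.s n * D.q n * n)
          * ((n : ℝ) ^ (2 * α - 1) * ((n : ℝ) ^ (-α)) ^ 2 * n) := by field_simp; ring
      _ = _ := by rw [h3, mul_one]
  have h5 : Tendsto (fun n : ℕ => (D.p n : ℝ≥0∞) * ENNReal.ofReal (Real.exp (D.q n
      - 8 * (w ^ 2 + 1) * (D.q n + Real.log (D.p n)) / (4 * (w ^ 2 + 1))))) atTop (𝓝 0) := by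
    have h6 : Tendsto (fun n : ℕ => ENNReal.ofReal (Real.exp (-(D.q n : ℝ)))) atTop (𝓝 0) := by
      rw [← ENNReal.ofReal_zero]
      exact ENNReal.tendsto_ofReal (Real.tendsto_exp_neg_atTop_nhds_zero.comp
        (tendsto_q_atTop hM hN))
    refine tendsto_of_tendsto_of_tendsto_of_le_of_le' tendsto_const_nhds h6
      (Eventually.of_forall fun _ => zero_le) ?_
    filter_upwards [hM.eventually_a_pos] with n ha
    have hp : (1 : ℝ) ≤ D.p n := by exact_mod_cast p_pos_of_pos ha
    rw [← ENNReal.ofReal_natCast, ← ENNReal.ofReal_mul (by positivity)]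
    refine ENNReal.ofReal_le_ofReal ?_
    have h7 : (D.p n : ℝ) = Real.exp (Real.log (D.p n)) := (Real.exp_log (by linarith)).symm
    have h8 : 8 * (w ^ 2 + 1) * (D.q n + Real.log (D.p n)) / (4 * (w ^ 2 + 1))
        = 2 * (D.q n + Real.log (D.p n)) := by field_simp; ring
    have h9 := Real.log_nonneg hp
    rw [h8]
    nth_rw 1 [h7]
    rw [← Real.exp_add]
    exact Real.exp_le_exp.2 (by linarith)
  simpa using h1.add h5

/-- The deterministic part of the error of the pivot vanishes. The penalty enters through
`√n · ρ'(a_n / 2) / a_n · n^{-α}`, which the rate condition on `ρ'(a_n / 2)` makes negligible. -/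
theorem tendsto_pivotError (hM : D.ModelCondition α) (hN : D.NormalityRates α) (c₀ C K : ℝ) :
    Tendsto (fun n : ℕ => √n * (C * ((D.s n : ℝ) * ((D.q n : ℝ) ^ 2)⁻¹))
      + √n / (c₀ * √c₀) * ((K * (n : ℝ) ^ (-(1 / 2) : ℝ)
        + deriv (D.pen n) (D.a n / 2) / (D.a n / 2)) * (n : ℝ) ^ (-α))) atTop (𝓝 0) := by
  have hhalf : ∀ {n : ℕ}, 0 < n → √(n : ℝ) * (n : ℝ) ^ (-(1 / 2) : ℝ) = 1 := fun {n} hn => by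
    have hn' : (0 : ℝ) < n := by exact_mod_cast hn
    rw [Real.sqrt_eq_rpow, ← Real.rpow_add hn']; norm_num
  have h1 : Tendsto (fun n : ℕ => √n * ((D.s n : ℝ) * ((D.q n : ℝ) ^ 2)⁻¹)) atTop (𝓝 0) := by
    refine tendsto_zero_of_eventually_abs_le fun ε hε => ?_
    filter_upwards [hN.eventually_approx_le hε, eventually_gt_atTop 0] with n h hn
    rw [abs_of_nonneg (by positivity)]
    calc _ ≤ √(n : ℝ) * (ε * (n : ℝ) ^ (-(1 / 2) : ℝ)) := by gcongr
      _ = ε * (√(n : ℝ) * (n : ℝ) ^ (-(1 / 2) : ℝ)) := by ring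
      _ = ε := by rw [hhalf hn, mul_one]
  have h2 : Tendsto (fun n : ℕ => (n : ℝ) ^ (-α)) atTop (𝓝 0) :=
    (tendsto_rpow_neg_atTop hM.alpha_mem.1).comp tendsto_natCast_atTop_atTop
  have h3 : Tendsto (fun n : ℕ => √n * (deriv (D.pen n) (D.a n / 2) / (D.a n / 2)
      * (n : ℝ) ^ (-α))) atTop (𝓝 0) := by
    refine tendsto_zero_of_eventually_abs_le fun ε hε => ?_
    filter_upwards [hN.deriv_small.def (half_pos hε), hM.eventually_a_pos, eventually_gt_atTop 0]
      with n h ha hn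
    have hn' : (0 : ℝ) < n := by exact_mod_cast hn
    have hs : (1 : ℝ) ≤ D.s n := by exact_mod_cast s_pos_of_pos ha
    have hd := hM.deriv_nonneg n (half_pos ha)
    rw [Real.norm_of_nonneg hd, Real.norm_of_nonneg (by positivity)] at h
    have h4 : (D.s n : ℝ) ^ (-(1 / 2) : ℝ) ≤ 1 :=
      Real.rpow_le_one_of_one_le_of_nonpos hs (by norm_num)
    have h5 : √(n : ℝ) * ((n : ℝ) ^ (α - 1 / 2) * (n : ℝ) ^ (-α)) = 1 := by
      rw [Real.sqrt_eq_rpow, ← Real.rpow_add hn', ← Real.rpow_add hn']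
      ring_nf
      simp
    rw [abs_of_nonneg (by positivity)]
    calc _ ≤ √(n : ℝ) * (ε / 2 * (D.a n * (n : ℝ) ^ (α - 1 / 2) * (D.s n : ℝ) ^ (-(1 / 2) : ℝ))
            / (D.a n / 2) * (n : ℝ) ^ (-α)) := by gcongr
      _ = ε * (D.s n : ℝ) ^ (-(1 / 2) : ℝ)
            * (√(n : ℝ) * ((n : ℝ) ^ (α - 1 / 2) * (n : ℝ) ^ (-α))) := by field_simp
      _ ≤ ε := by rw [h5, mul_one]; exact mul_le_of_le_one_right hε.le h4
  have h6 := (h1.const_mul C).add (((h2.const_mul K).add h3).const_mul (1 / (c₀ * √c₀)))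
  simp only [mul_zero, add_zero] at h6
  refine h6.congr' ?_
  filter_upwards [eventually_gt_atTop 0] with n hn
  have h7 := hhalf hn
  linear_combination (-(K * (n : ℝ) ^ (-α)) / (c₀ * √c₀)) * h7

end LinearFAR

theorem theorem2 (σ : ℝ≥0) :
    ∃ κ : ℝ, 0 < κ ∧
      ∀ (D : LinearFAR) (α : ℝ), D.BasisCondition → D.ModelCondition α →
        D.SelectionRates α κ → D.NormalityRates α →
      ∀ (Ω : ℕ → Type*) [∀ n, MeasurableSpace (Ω n)] (P : ∀ n, Measure (Ω n))
        [∀ n, IsProbabilityMeasure (P n)] (ε : ∀ n, Fin n → Ω n → ℝ),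
        (∀ n, iIndepFun (ε n) (P n)) →
        (∀ n i, HasLaw (ε n i) (gaussianReal 0 (σ ^ 2)) (P n)) →
      ∃ (η : ∀ n, Ω n → Fin (D.p n) → Fin (D.q n) → ℝ) (A : ∀ n, Set (Ω n)),
        (∀ n, AEMeasurable (η n) (P n)) ∧
        (∀ n, MeasurableSet (A n)) ∧
        Tendsto (fun n => P n (A n)) atTop (𝓝 1) ∧
        (∀ n, ∀ ω ∈ A n,
          IsStrictLocalMin (D.criterion n (D.response n fun i => ε n i ω)) (η n ω) ∧
          ∀ j ∉ D.M0 n, η n ω j = 0) ∧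
        ∀ c : ∀ n, D.M0 n × Fin (D.q n) → ℝ, (∀ᶠ n in atTop, c n ⬝ᵥ c n = 1) →
          TendstoInDistribution (fun n ω => c n ⬝ᵥ D.pivot n (η n ω)) atTop
            (id : ℝ → ℝ) P (gaussianReal 0 (σ ^ 2)) := by
  classical
  have hv : (0 : ℝ) < (σ : ℝ) ^ 2 + 1 := by positivity
  refine ⟨1 / (128 * ((σ : ℝ) ^ 2 + 1)), by positivity, ?_⟩
  intro D α hB hM hS hN Ω _ P _ ε hind hlaw
  obtain ⟨c₀, C, K, hc₀, hreg⟩ := LinearFAR.eventually_regularSample hB hM hv hS hN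
  set Kn : ℕ → ℝ := fun n => K * (n : ℝ) ^ (-(1 / 2) : ℝ) with hKn
  set δ : ℕ → ℝ := fun n => (n : ℝ) ^ (-α) with hδ
  set R : ℕ → ℝ := fun n => C * ((D.s n : ℝ) * ((D.q n : ℝ) ^ 2)⁻¹) with hR
  set g : ℕ → ℝ := fun n => c₀ / 8 * (n : ℝ) ^ (-α) with hg
  set τ : ℕ → ℝ := fun n => 8 * ((σ : ℝ) ^ 2 + 1) * (D.q n + Real.log (D.p n)) with hτ
  have hsol : ∀ n, ∃ u : (Fin n → ℝ) → EuclideanSpace ℝ (D.M0 n × Fin (D.q n)), Measurable u ∧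
      (D.RegularSample n c₀ (Kn n) (δ n) (R n) (g n) (τ n) →
        ∀ e ∈ D.goodErrors n (g n) (τ n), D.IsSolution n (δ n) e (u e)) := fun n => by
    by_cases H : D.RegularSample n c₀ (Kn n) (δ n) (R n) (g n) (τ n)
    · obtain ⟨u, hu1, hu2⟩ := H.exists_measurable_solution
      exact ⟨u, hu1, fun _ => hu2⟩
    · exact ⟨fun _ => 0, measurable_const, fun h => absurd h H⟩
  choose u hu_meas hu using hsol
  -- the errors are only almost everywhere measurable, so the event is replaced by a measurable
  -- subset of the same probability
  have hε : ∀ n, AEMeasurable (fun ω i => ε n i ω) (P n) := fun n =>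
    aemeasurable_pi_lambda _ fun i => (hlaw n i).aemeasurable
  have hA : ∀ n, ∃ A : Set (Ω n), MeasurableSet A ∧
      (∀ ω ∈ A, D.RegularSample n c₀ (Kn n) (δ n) (R n) (g n) (τ n) ∧
        (fun i => ε n i ω) ∈ D.goodErrors n (g n) (τ n)) ∧
      (D.RegularSample n c₀ (Kn n) (δ n) (R n) (g n) (τ n) →
        P n A = P n {ω | (fun i => ε n i ω) ∈ D.goodErrors n (g n) (τ n)}) := fun n => by
    by_cases H : D.RegularSample n c₀ (Kn n) (δ n) (R n) (g n) (τ n)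
    · have hnull : NullMeasurableSet {ω | (fun i => ε n i ω) ∈ D.goodErrors n (g n) (τ n)} (P n) :=
        (hε n).nullMeasurableSet_preimage (D.isOpen_goodErrors n (g n) (τ n)).measurableSet
      obtain ⟨A, hAsub, hAm, hAe⟩ := hnull.exists_measurable_subset_ae_eq
      exact ⟨A, hAm, fun ω hω => ⟨H, hAsub hω⟩, fun _ => measure_congr hAe⟩
    · exact ⟨∅, MeasurableSet.empty, fun ω hω => absurd hω (Set.notMem_empty ω),
        fun h => absurd h H⟩
  choose A hAm hAsub hAP using hA
  have hη : ∀ n, AEMeasurable (fun ω => LinearFAR.fullCoef (u n fun i => ε n i ω)) (P n) :=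
    fun n => LinearFAR.continuous_fullCoef.measurable.comp_aemeasurable
      ((hu_meas n).comp_aemeasurable (hε n))
  have hPA : Tendsto (fun n => P n (A n)) atTop (𝓝 1) := by
    have h1 : Tendsto (fun n => P n (A n)ᶜ) atTop (𝓝 0) := by
      refine tendsto_of_tendsto_of_tendsto_of_le_of_le' tendsto_const_nhds
        (LinearFAR.tendsto_badProb hM hS hN (w := σ) hc₀)
        (Eventually.of_forall fun _ => zero_le) ?_
      filter_upwards [hreg, eventually_gt_atTop 0] with n H hn
      have hn' : (0 : ℝ) < n := by exact_mod_cast hn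
      have hnull : NullMeasurableSet {ω | (fun i => ε n i ω) ∈ D.goodErrors n (g n) (τ n)} (P n) :=
        (hε n).nullMeasurableSet_preimage (D.isOpen_goodErrors n (g n) (τ n)).measurableSet
      have h2 := H.measure_notMem_goodErrors_le (by positivity) (hind n) (hlaw n)
      refine le_trans (le_of_eq ?_) h2
      rw [prob_compl_eq_one_sub (hAm n), hAP n H, ← prob_compl_eq_one_sub₀ hnull]
      rfl
    have h3 := ENNReal.Tendsto.sub tendsto_const_nhds h1 (Or.inl ENNReal.one_ne_top)
    rw [tsub_zero] at h3
    refine h3.congr fun n => ?_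
    rw [prob_compl_eq_one_sub (hAm n), ENNReal.sub_sub_cancel ENNReal.one_ne_top prob_le_one]
  refine ⟨fun n ω => LinearFAR.fullCoef (u n fun i => ε n i ω), A, hη, hAm, hPA,
    fun n ω hω => ?_, fun c hc => ?_⟩
  · obtain ⟨H, he⟩ := hAsub n ω hω
    exact ⟨H.isStrictLocalMin he (hu n H _ he), fun j hj => LinearFAR.fullCoef_of_notMem _ hj⟩
  · refine tendstoInDistribution_of_abs_sub_le (A := A)
      (Z := fun n ω => ((D.ThetaM0 n * (CFC.sqrt (D.gramM0 n))⁻¹) *ᵥ c n) ⬝ᵥ fun i => ε n i ω)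
      (fun n => ?_) hAm hPA (LinearFAR.tendsto_pivotError hM hN c₀ C K) ?_
    · have hcont : Continuous fun η : Fin (D.p n) → Fin (D.q n) → ℝ => c n ⬝ᵥ D.pivot n η := by
        unfold LinearFAR.pivot
        fun_prop
      exact hcont.measurable.comp_aemeasurable (hη n)
    · filter_upwards [hreg, hc] with n H hcn
      refine ⟨hasLaw_dotProduct_gaussianReal (hind n) (hlaw n) _ ?_, fun ω hω => ?_⟩
      · have hV : (D.ThetaM0 n * (CFC.sqrt (D.gramM0 n))⁻¹)ᵀ
            * (D.ThetaM0 n * (CFC.sqrt (D.gramM0 n))⁻¹) = 1 :=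
          whitened_transpose_mul_self H.isUnit_gramM0
        rw [mulVec_dotProduct_mulVec, hV, one_mulVec, hcn, mul_one]
        rfl
      · exact H.abs_dotProduct_pivot_sub_le (hu n H _ (hAsub n ω hω).2) hcn
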